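/- Let $q$ be odd, and let $\mathbf{E}_q$ be one of the following commutative rings with involution $x\mapsto\bar x$: the field $\mathbf{F}_{q^2}$ with $\bar x=x^q$ (unitary case), or $\mathbf{F}_q\oplus\mathbf{F}_q$ with $\overline{(x,y)}=(y,x)$ (linear case). For $m\ge 1$ let $P_{m+1}$ be the pure braid group on the strands $0,\dots,m$, with $s_i$ the standard generator of the braid group exchanging strands $i,i+1$. Let the braid group act on the free group on $x_0,\dots,x_m$ by Artin's action ($s_i: x_i\mapsto x_ix_{i+1}x_i^{-1},\ x_{i+1}\mapsto x_i$). For $t_0,\dots,t_m\in\mathbf{E}_q^\times$ with all $1-t_i$ units, the specialized Gassner representation of $P_{m+1}$ on $\mathbf{E}_q^{m+1}$ sends $\beta$ to the Fox Jacobian $e_j\mapsto\sum_k \frac{\partial \beta(x_j)}{\partial x_k}\big|_{x=t}\,e_k$, and the specialized reduced Gassner representation $\bar g_m(t_0,\dots,t_m)$ is its restriction to the kernel of the linear form $e_j\mapsto t_j-1$. This kernel is free of rank $m$ with basis $\varepsilon_i=(1-t_i)^{-1}e_i-(1-t_{i+1})^{-1}e_{i+1}$ $(0\le i<m)$, and $s_i^2$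 acts by $\varepsilon_{i-1}\mapsto\varepsilon_{i-1}+t_i(1-t_{i+1})\varepsilon_i$, $\varepsilon_i\mapsto t_it_{i+1}\varepsilon_i$, $\varepsilon_{i+1}\mapsto\varepsilon_{i+1}+(1-t_i)\varepsilon_i$, fixing the other basis vectors. If $\bar t_i=t_i^{-1}$ for all $i$, it preserves the skew-Hermitian form $h$ (linear in the first variable) with $h(\varepsilon_i,\varepsilon_i)=\frac{1-t_it_{i+1}}{(1-t_i)(1-t_{i+1})}$, $h(\varepsilon_{i+1},\varepsilon_i)=-\frac{1}{1-t_{i+1}}$, $h(\varepsilon_i,\varepsilon_{i+1})=-\frac{t_{i+1}}{1-t_{i+1}}$, and $h(\varepsilon_i,\varepsilon_j)=0$ for $|i-j|>1$. For a vector $v$ of a submodule $W$, a linear automorphism acts on $W$ as a transvection along $v$ if it is $w\mapsto w+\varphi(w)v$ on $W$ for a linear functional $\varphi$ on $W$ with $\varphi(v)=0$. A unitary transvection along $v$ is an automorphism that preserves $h$ and acts on the whole space as a transvection along $v$. A vector $v$ is isotropic if $h(v,v)=0$ and $v\ne0$, where in the linear case both components of $v$ are required to be nonzero. **Proposition.**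 Let $n>2$ and let $t_0,\dots,t_{n+1}\in\mathbf{E}_q^\times$ satisfy $\bar t_i=t_i^{-1}$ and $t_i-1\in\mathbf{E}_q^\times$ for all $i$; assume that $t_0,\dots,t_n$ generate $\mathbf{E}_q$ as a ring and that $t_0t_1\cdots t_n=1$. (If $\mathbf{E}_q=\mathbf{Z}[\zeta_l]/\mathfrak{p}$, where $p\neq l$ are odd primes and $\mathfrak p$ is a prime of $\mathbf{Z}[\zeta_l+\zeta_l^{-1}]$ above $p$ with residue field of order $q$, then all conditions other than $n>2$ and $t_0\cdots t_n=1$ hold when every $t_i$ is the image of a nontrivial $l$-th root of unity.) Then there is an isotropic vector $v$ in the space of $\bar g_{n+1}(t_0,\dots,t_{n+1})$ such that the image of $\bar g_{n+1}(t_0,\dots,t_{n+1})$ contains all unitary transvections along $v$. More precisely, let $W=\langle\varepsilon_0,\dots,\varepsilon_{n-1}\rangle$, the space of the degenerate representation $\bar g_n(t_0,\dots,t_n)$. Then $v$ can be chosen to span the kernel of $h|_W$, and so that every unitary transvection along $v$ is the commutator $\bar g_{n+1}(aba^{-1}b^{-1})$ of the images of two pure braids $a,b$ on the strands $0,\dots,n$,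 each of which acts on $W$ as a transvection along $v$. -/

import Mathlib

noncomputable section

namespace Gassner

/-! ### Artin's braid groups and the action on the free group -/

/-- The defining relators of Artin's braid group on the `n + 1` strands `0, …, n`, with standard
generators `s_0, …, s_{n-1}`, where `s_i` exchanges the strands `i` and `i + 1`. -/
def braidRelators (n : ℕ) : Set (FreeGroup (Fin n)) :=
  {r | ∃ i j : Fin n, (i : ℕ) + 1 = j ∧
    r = .of i * .of j * .of i * (.of j * .of i * .of j)⁻¹} ∪
  {r | ∃ i j : Fin n, (i : ℕ) + 1 < j ∧ r = .of i * .of j * (.of j * .of i)⁻¹}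

/-- Artin's braid group on the `n + 1` strands `0, …, n`. -/
abbrev BraidGroup (n : ℕ) : Type := PresentedGroup (braidRelators n)

theorem strandPerm_relators (n : ℕ) : ∀ r ∈ braidRelators n,
    FreeGroup.lift (fun i : Fin n => Equiv.swap i.castSucc i.succ) r = 1 := by
  rintro r (⟨i, j, hij, rfl⟩ | ⟨i, j, hij, rfl⟩)
  · simp only [map_mul, map_inv, FreeGroup.lift_apply_of, mul_inv_eq_one]
    ext k
    simp only [Equiv.Perm.mul_apply, Equiv.swap_apply_def, Fin.ext_iff, Fin.val_castSucc,
      Fin.val_succ]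
    grind
  · simp only [map_mul, map_inv, FreeGroup.lift_apply_of, mul_inv_eq_one]
    ext k
    simp only [Equiv.Perm.mul_apply, Equiv.swap_apply_def, Fin.ext_iff, Fin.val_castSucc,
      Fin.val_succ]
    grind

/-- The permutation of the strands underlying a braid. -/
def strandPerm (n : ℕ) : BraidGroup n →* Equiv.Perm (Fin (n + 1)) :=
  PresentedGroup.toGroup (strandPerm_relators n)

/-- The pure braid group `P_{n+1}` on the `n + 1` strands `0, …, n`. -/
abbrev PureBraidGroup (n : ℕ) : Subgroup (BraidGroup n) := (strandPerm n).ker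

/-- Artin's automorphism attached to `s_i`: it sends `x_i` to `x_i x_{i+1} x_i⁻¹` and `x_{i+1}` to
`x_i`, and it fixes the other free generators. -/
def artinFun {n : ℕ} (i : Fin n) (k : Fin (n + 1)) : FreeGroup (Fin (n + 1)) :=
  if k = i.castSucc then .of i.castSucc * .of i.succ * (.of i.castSucc)⁻¹
  else if k = i.succ then .of i.castSucc else .of k

/-- The inverse of `artinFun i`: it sends `x_i` to `x_{i+1}` and `x_{i+1}` to
`x_{i+1}⁻¹ x_i x_{i+1}`. -/
def artinInvFun {n : ℕ} (i : Fin n) (k : Fin (n + 1)) : FreeGroup (Fin (n + 1)) :=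
  if k = i.castSucc then .of i.succ
  else if k = i.succ then (.of i.succ)⁻¹ * .of i.castSucc * .of i.succ else .of k

theorem artin_left_inv {n : ℕ} (i : Fin n) :
    (FreeGroup.lift (artinInvFun i)).comp (FreeGroup.lift (artinFun i)) = MonoidHom.id _ := by
  ext k
  have h : i.succ ≠ i.castSucc := by simp [Fin.ext_iff]
  by_cases h1 : k = i.castSucc
  · subst h1; simp [artinFun, artinInvFun, h, mul_assoc]
  · by_cases h2 : k = i.succ
    · subst h2; simp [artinFun, artinInvFun, h]
    · simp [artinFun, artinInvFun, h1, h2]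

theorem artin_right_inv {n : ℕ} (i : Fin n) :
    (FreeGroup.lift (artinFun i)).comp (FreeGroup.lift (artinInvFun i)) = MonoidHom.id _ := by
  ext k
  have h : i.succ ≠ i.castSucc := by simp [Fin.ext_iff]
  by_cases h1 : k = i.castSucc
  · subst h1; simp [artinFun, artinInvFun, h]
  · by_cases h2 : k = i.succ
    · subst h2; simp [artinFun, artinInvFun, h, mul_assoc]
    · simp [artinFun, artinInvFun, h1, h2]

/-- Artin's automorphism of the free group attached to the generator `s_i`. -/
def artinAut {n : ℕ} (i : Fin n) : MulAut (FreeGroup (Fin (n + 1))) :=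
  MonoidHom.toMulEquiv (FreeGroup.lift (artinFun i)) (FreeGroup.lift (artinInvFun i))
    (artin_left_inv i) (artin_right_inv i)

theorem artinAut_of {n : ℕ} (i : Fin n) (k : Fin (n + 1)) :
    artinAut i (.of k) = artinFun i k := by
  simp [artinAut, MonoidHom.toMulEquiv]

theorem mulAut_ext {α : Type*} {f g : MulAut (FreeGroup α)}
    (h : ∀ k, f (.of k) = g (.of k)) : f = g := by
  have : f.toMonoidHom = g.toMonoidHom := FreeGroup.ext_hom _ _ h
  exact MulEquiv.toMonoidHom_injective this

theorem artin_relators (n : ℕ) : ∀ r ∈ braidRelators n,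
    FreeGroup.lift (fun i : Fin n => artinAut i) r = 1 := by
  rintro r (⟨i, j, hij, rfl⟩ | ⟨i, j, hij, rfl⟩)
  · simp only [map_mul, map_inv, FreeGroup.lift_apply_of, mul_inv_eq_one]
    have e : j.castSucc = i.succ := by ext; simp [hij]
    have h1 : i.succ ≠ i.castSucc := by simp [Fin.ext_iff]
    have h2 : j.succ ≠ i.castSucc := by simp [Fin.ext_iff]; omega
    have h3 : j.succ ≠ i.succ := by simp [Fin.ext_iff]; omega
    refine mulAut_ext fun k => ?_
    by_cases k1 : k = i.castSucc
    · subst k1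
      simp [MulAut.mul_apply, artinAut_of, artinFun, e, h1, h1.symm, h2, h2.symm, h3,
        mul_assoc]
    · by_cases k2 : k = i.succ
      · subst k2
        simp [MulAut.mul_apply, artinAut_of, artinFun, e, h1, h1.symm, h2, h2.symm, h3,
          mul_assoc]
      · by_cases k3 : k = j.succ
        · subst k3
          simp [MulAut.mul_apply, artinAut_of, artinFun, e, h1, h1.symm, h2, h2.symm, h3]
        · simp [MulAut.mul_apply, artinAut_of, artinFun, e, k1, k2, k3]
  · simp only [map_mul, map_inv, FreeGroup.lift_apply_of, mul_inv_eq_one]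
    have a1 : j.castSucc ≠ i.castSucc := by simp [Fin.ext_iff]; omega
    have a2 : j.castSucc ≠ i.succ := by simp [Fin.ext_iff]; omega
    have a3 : j.succ ≠ i.castSucc := by simp [Fin.ext_iff]; omega
    have a4 : j.succ ≠ i.succ := by simp [Fin.ext_iff]; omega
    have a5 : i.succ ≠ i.castSucc := by simp [Fin.ext_iff]
    have a6 : j.succ ≠ j.castSucc := by simp [Fin.ext_iff]
    refine mulAut_ext fun k => ?_
    by_cases k1 : k = i.castSucc
    · subst k1
      simp [MulAut.mul_apply, artinAut_of, artinFun, a1.symm, a2.symm, a3.symm, a4.symm]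
    · by_cases k2 : k = i.succ
      · subst k2
        simp [MulAut.mul_apply, artinAut_of, artinFun, a1.symm, a2.symm, a3.symm, a4.symm, a5]
      · by_cases k3 : k = j.castSucc
        · subst k3
          simp [MulAut.mul_apply, artinAut_of, artinFun, a1, a2, a3, a4]
        · by_cases k4 : k = j.succ
          · subst k4
            simp [MulAut.mul_apply, artinAut_of, artinFun, a1, a2, a3, a4, a6]
          · simp [MulAut.mul_apply, artinAut_of, artinFun, k1, k2, k3, k4]

/-- Artin's action of the braid group on `n + 1` strands on the free group of rank `n + 1`. -/
def artinAction (n : ℕ) : BraidGroup n →* MulAut (FreeGroup (Fin (n + 1))) :=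
  PresentedGroup.toGroup (artin_relators n)

/-! ### The specialized Gassner representation, by Fox calculus -/

section Rep

variable {E : Type*} [CommRing E] {n : ℕ}

/-- The character `x_i ↦ t_i` of the free group. -/
def character (t : Fin (n + 1) → Eˣ) : FreeGroup (Fin (n + 1)) →* Eˣ := FreeGroup.lift t

/-- The affine bijection `m ↦ e_j + t_j m` of `E ^ (n + 1)`. -/
def foxStep (t : Fin (n + 1) → Eˣ) (j : Fin (n + 1)) : Equiv.Perm (Fin (n + 1) → E) where
  toFun m := Pi.single j 1 + t j • m
  invFun m := (t j)⁻¹ • (m - Pi.single j 1)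
  left_inv m := by simp
  right_inv m := by simp

/-- The vector `(∂w/∂x_0, …, ∂w/∂x_n)` of Fox derivatives of a word `w`, evaluated at `x_i = t_i`.
It is characterized by `foxDeriv_of` and `foxDeriv_mul` below. -/
def foxDeriv (t : Fin (n + 1) → Eˣ) (w : FreeGroup (Fin (n + 1))) : Fin (n + 1) → E :=
  FreeGroup.lift (foxStep t) w 0

theorem foxDeriv_of (t : Fin (n + 1) → Eˣ) (j : Fin (n + 1)) :
    foxDeriv t (.of j) = Pi.single j 1 := by
  simp [foxDeriv, foxStep]

theorem lift_foxStep (t : Fin (n + 1) → Eˣ) (w : FreeGroup (Fin (n + 1)))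
    (m : Fin (n + 1) → E) :
    FreeGroup.lift (foxStep t) w m = foxDeriv t w + character t w • m := by
  induction w using FreeGroup.induction_on generalizing m with
  | C1 => simp [foxDeriv]
  | of j => simp [foxDeriv, foxStep, character]
  | inv_of j _ =>
    have h : ∀ m, (foxStep t j)⁻¹ m = (t j)⁻¹ • (m - Pi.single j 1) := fun m => rfl
    simp only [foxDeriv, character, map_inv, FreeGroup.lift_apply_of, h]
    rw [← smul_add]; congr 1; abel
  | mul a b ha hb =>
    have h : foxDeriv t (a * b) = foxDeriv t a + character t a • foxDeriv t b := by
      rw [foxDeriv, map_mul, Equiv.Perm.mul_apply, ha]; rfl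
    rw [map_mul, Equiv.Perm.mul_apply, hb, ha, h, map_mul, smul_add, mul_smul, add_assoc]

theorem foxDeriv_mul (t : Fin (n + 1) → Eˣ) (a b : FreeGroup (Fin (n + 1))) :
    foxDeriv t (a * b) = foxDeriv t a + character t a • foxDeriv t b := by
  rw [foxDeriv, map_mul, Equiv.Perm.mul_apply, lift_foxStep]; rfl

theorem foxDeriv_one (t : Fin (n + 1) → Eˣ) : foxDeriv t 1 = 0 := by simp [foxDeriv]

theorem foxDeriv_inv (t : Fin (n + 1) → Eˣ) (a : FreeGroup (Fin (n + 1))) :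
    foxDeriv t a⁻¹ = -((character t a)⁻¹ • foxDeriv t a) := by
  have h := foxDeriv_mul t a⁻¹ a
  rw [inv_mul_cancel, foxDeriv_one, map_inv] at h
  exact eq_neg_of_add_eq_zero_left h.symm

theorem character_artin (β : BraidGroup n) : ∀ (t : Fin (n + 1) → Eˣ)
    (w : FreeGroup (Fin (n + 1))),
    character t (artinAction n β w) = character (fun k => t (strandPerm n β k)) w := by
  suffices h : ∀ (t : Fin (n + 1) → Eˣ), (character t).comp (artinAction n β).toMonoidHom =
      character (fun k => t (strandPerm n β k)) by
    intro t w; exact DFunLike.congr_fun (h t) w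
  have key : ∀ (i : Fin n) (t : Fin (n + 1) → Eˣ),
      (character t).comp (artinAut i).toMonoidHom =
        character (fun k => t (Equiv.swap i.castSucc i.succ k)) := by
    intro i t
    refine FreeGroup.ext_hom _ _ fun k => ?_
    have h : i.succ ≠ i.castSucc := by simp [Fin.ext_iff]
    simp only [MonoidHom.comp_apply, MulEquiv.coe_toMonoidHom, artinAut_of]
    by_cases k1 : k = i.castSucc
    · subst k1; simp [artinFun, character]
    · by_cases k2 : k = i.succ
      · subst k2; simp [artinFun, character, h]
      · simp [artinFun, character, k1, k2, Equiv.swap_apply_of_ne_of_ne k1 k2]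
  obtain ⟨w, rfl⟩ := PresentedGroup.mk_surjective (braidRelators n) β
  induction w using FreeGroup.induction_on with
  | C1 => intro t; simp only [map_one]; rfl
  | of i => exact key i
  | inv_of i _ =>
    intro t
    have h := key i (fun k => t ((Equiv.swap i.castSucc i.succ)⁻¹ k))
    have e1 : artinAction n (PresentedGroup.mk _ (FreeGroup.of i)⁻¹) = (artinAut i)⁻¹ := by
      rw [map_inv, map_inv]; rfl
    have e2 : strandPerm n (PresentedGroup.mk _ (FreeGroup.of i)⁻¹) =
        (Equiv.swap i.castSucc i.succ)⁻¹ := by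
      rw [map_inv, map_inv]; rfl
    rw [e1, e2]
    have h0 : (fun k => t ((Equiv.swap i.castSucc i.succ)⁻¹
        (Equiv.swap i.castSucc i.succ k))) = t := by
      funext k; simp
    rw [h0] at h
    ext1 k
    have h' := DFunLike.congr_fun h ((artinAut i)⁻¹ (.of k))
    simp only [MonoidHom.comp_apply, MulEquiv.coe_toMonoidHom, MulAut.apply_inv_self] at h' ⊢
    exact h'.symm
  | mul a b ha hb =>
    intro t
    ext1 k
    have h1 := DFunLike.congr_fun (ha t)
      (artinAction n (PresentedGroup.mk _ b) (.of k))
    have h2 := DFunLike.congr_fun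
      (hb (fun k => t (strandPerm n (PresentedGroup.mk _ a) k))) (.of k)
    simp only [MonoidHom.comp_apply, MulEquiv.coe_toMonoidHom] at h1 h2 ⊢
    simp only [map_mul, MulAut.mul_apply, Equiv.Perm.mul_apply] at h1 h2 ⊢
    exact h1.trans h2

theorem character_pure (β : PureBraidGroup n) (t : Fin (n + 1) → Eˣ)
    (w : FreeGroup (Fin (n + 1))) :
    character t (artinAction n β w) = character t w := by
  rw [character_artin, show strandPerm n β = 1 from β.2]; rfl

/-- The Fox Jacobian of a braid `β` at `x_i = t_i`: the linear map `e_j ↦ (∂β(x_j)/∂x_k)_k`. -/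
def foxJacobian (t : Fin (n + 1) → Eˣ) (β : BraidGroup n) :
    (Fin (n + 1) → E) →ₗ[E] (Fin (n + 1) → E) :=
  (Pi.basisFun E (Fin (n + 1))).constr E fun j => foxDeriv t (artinAction n β (.of j))

theorem foxJacobian_single (t : Fin (n + 1) → Eˣ) (β : BraidGroup n) (j : Fin (n + 1)) :
    foxJacobian t β (Pi.single j 1) = foxDeriv t (artinAction n β (.of j)) := by
  rw [foxJacobian, ← Pi.basisFun_apply E, Module.Basis.constr_basis]

theorem foxJacobian_foxDeriv (t : Fin (n + 1) → Eˣ) (β : PureBraidGroup n)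
    (w : FreeGroup (Fin (n + 1))) :
    foxJacobian t (β : BraidGroup n) (foxDeriv t w) = foxDeriv t (artinAction n β w) := by
  have hs : ∀ (u : Eˣ) (m : Fin (n + 1) → E), foxJacobian t (β : BraidGroup n) (u • m) =
      u • foxJacobian t (β : BraidGroup n) m := fun u m => map_smul _ (u : E) m
  induction w using FreeGroup.induction_on with
  | C1 => simp [foxDeriv_one]
  | of j => rw [foxDeriv_of, foxJacobian_single]
  | inv_of j h =>
    rw [foxDeriv_inv, map_inv, foxDeriv_inv, map_neg, hs, h, character_pure]
  | mul a b ha hb =>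
    rw [foxDeriv_mul, map_mul, foxDeriv_mul, map_add, hs, ha, hb, character_pure]

/-- The specialized Gassner representation of the pure braid group `P_{n+1}` on `E ^ (n + 1)`. -/
def gassner (t : Fin (n + 1) → Eˣ) :
    PureBraidGroup n →* Module.End E (Fin (n + 1) → E) where
  toFun β := foxJacobian t β
  map_one' := by
    refine (Pi.basisFun E (Fin (n + 1))).ext fun j => ?_
    simp only [Pi.basisFun_apply, OneMemClass.coe_one, foxJacobian_single, map_one,
      MulAut.one_apply, foxDeriv_of, Module.End.one_apply]
  map_mul' α β := by
    refine (Pi.basisFun E (Fin (n + 1))).ext fun j => ?_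
    simp only [Pi.basisFun_apply, Subgroup.coe_mul, foxJacobian_single, map_mul,
      MulAut.mul_apply, Module.End.mul_apply, foxJacobian_foxDeriv]

/-- The linear form `e_j ↦ t_j - 1` on `E ^ (n + 1)`. -/
def boundary (t : Fin (n + 1) → Eˣ) : (Fin (n + 1) → E) →ₗ[E] E :=
  Fintype.linearCombination E fun j => (t j : E) - 1

theorem boundary_foxDeriv (t : Fin (n + 1) → Eˣ) (w : FreeGroup (Fin (n + 1))) :
    boundary t (foxDeriv t w) = (character t w : E) - 1 := by
  have hs : ∀ (u : Eˣ) (m : Fin (n + 1) → E), boundary t (u • m) = (u : E) * boundary t m :=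
    fun u m => map_smul (boundary t) (u : E) m
  induction w using FreeGroup.induction_on with
  | C1 => simp [foxDeriv_one]
  | of j => simp [foxDeriv_of, boundary, character, Fintype.linearCombination_apply_single]
  | inv_of j h =>
    rw [foxDeriv_inv, map_neg, hs, h, map_inv]
    simp [mul_sub]
  | mul a b ha hb =>
    rw [foxDeriv_mul, map_add, hs, ha, hb, map_mul, Units.val_mul]; ring

theorem boundary_gassner (t : Fin (n + 1) → Eˣ) (β : PureBraidGroup n) (x : Fin (n + 1) → E) :
    boundary t (gassner t β x) = boundary t x := by
  have : (boundary t).comp (gassner t β) = boundary t := by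
    refine (Pi.basisFun E (Fin (n + 1))).ext fun j => ?_
    have h := boundary_foxDeriv t (artinAction n β (.of j))
    rw [character_pure, ← boundary_foxDeriv, foxDeriv_of] at h
    simpa [gassner, foxJacobian_single] using h
  exact DFunLike.congr_fun this x

/-- The space of the specialized reduced Gassner representation: the kernel of the linear form
`e_j ↦ t_j - 1`. When all `1 - t_j` are units it is free of rank `n`, with the basis
`ε_i = (1 - t_i)⁻¹ e_i - (1 - t_{i+1})⁻¹ e_{i+1}`, `0 ≤ i < n`. -/
abbrev ReducedSpace (t : Fin (n + 1) → Eˣ) : Submodule E (Fin (n + 1) → E) :=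
  LinearMap.ker (boundary t)

/-- The specialized reduced Gassner representation of `P_{n+1}` at `t_0, …, t_n`, as a homomorphism
to the group of linear automorphisms of its space. -/
def reducedGassner (t : Fin (n + 1) → Eˣ) :
    PureBraidGroup n →* LinearMap.GeneralLinearGroup E (ReducedSpace t) :=
  MonoidHom.toHomUnits
    { toFun := fun β => (gassner t β).restrict fun x hx => by
        rw [LinearMap.mem_ker] at hx ⊢
        rw [boundary_gassner, hx]
      map_one' := by ext x : 2; simp [LinearMap.restrict_apply]
      map_mul' := fun α β => by ext x : 2; simp [LinearMap.restrict_apply] }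

/-! ### The skew-Hermitian form and unitary transvections -/

variable [StarRing E]

/-- The skew-Hermitian form `h` of the reduced Gassner representation, linear in the first and
conjugate-linear in the second variable. If the `1 - t_i` are units and `star t_i = t_i⁻¹`, its Gram
matrix in the basis `ε_i` is tridiagonal with
`h(ε_i, ε_i) = (1 - t_i t_{i+1}) / ((1 - t_i) (1 - t_{i+1}))`,
`h(ε_{i+1}, ε_i) = - 1 / (1 - t_{i+1})` and `h(ε_i, ε_{i+1}) = - t_{i+1} / (1 - t_{i+1})`. -/
def gassnerForm (t : Fin (n + 1) → Eˣ) (x y : ReducedSpace t) : E :=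
  ∑ i, (1 - star (t i : E)) * (x : Fin (n + 1) → E) i * star ((y : Fin (n + 1) → E) i) +
  ∑ i, ∑ j ∈ Finset.Ioi i, ((1 - (t i : E)) * (x : Fin (n + 1) → E) i) *
    star ((1 - (t j : E)) * (y : Fin (n + 1) → E) j)

/-- A vector is isotropic if `h(v, v) = 0` and no nonzero scalar kills `v`. Over a field the second
condition is `v ≠ 0`; over `F × F` it says that both components of `v` are nonzero. -/
def IsIsotropic (t : Fin (n + 1) → Eˣ) (v : ReducedSpace t) : Prop :=
  gassnerForm t v v = 0 ∧ ∀ a : E, a • v = 0 → a = 0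

/-- `T` preserves the form `h`. -/
def IsUnitary (t : Fin (n + 1) → Eˣ) (T : LinearMap.GeneralLinearGroup E (ReducedSpace t)) : Prop :=
  ∀ x y, gassnerForm t (T.1 x) (T.1 y) = gassnerForm t x y

/-- On the submodule `W`, which contains `v`, the automorphism `T` acts as a transvection along `v`,
that is as `w ↦ w + φ(w) v` for a linear functional `φ` on `W` with `φ(v) = 0`. -/
def IsTransvectionOn {V : Type*} [AddCommGroup V] [Module E V] (W : Submodule E V) (v : V)
    (T : LinearMap.GeneralLinearGroup E V) : Prop :=
  ∃ (hv : v ∈ W) (φ : W →ₗ[E] E), φ ⟨v, hv⟩ = 0 ∧ ∀ w : W, T.1 (w : V) = w + φ w • v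

/-- A unitary transvection along `v`: a transvection along `v` that preserves `h`. -/
def IsUnitaryTransvection (t : Fin (n + 1) → Eˣ) (v : ReducedSpace t)
    (T : LinearMap.GeneralLinearGroup E (ReducedSpace t)) : Prop :=
  IsUnitary t T ∧ IsTransvectionOn ⊤ v T

/-- The coordinate hyperplane `⟨ε_0, …, ε_{n-1}⟩` of the space of the representation at
`t_0, …, t_{n+1}`: the vectors that do not involve the last strand. It is the space of the
representation at `t_0, …, t_n`. -/
def coordHyperplane (t : Fin (n + 2) → Eˣ) : Submodule E (ReducedSpace t) :=
  LinearMap.ker ((LinearMap.proj (Fin.last (n + 1))).comp (ReducedSpace t).subtype)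

end Rep

/-- The pure braids on the strands `0, …, n + 1` whose last strand is not involved: the copy of the
pure braid group on the strands `0, …, n` given by the generators `s_0, …, s_{n-1}`. -/
def firstStrands (n : ℕ) : Subgroup (PureBraidGroup (n + 1)) :=
  (Subgroup.closure (Set.range fun i : Fin n =>
    (PresentedGroup.of i.castSucc : BraidGroup (n + 1)))).subgroupOf (PureBraidGroup (n + 1))

/-- `E` with its involution `star` is the ring of scalars `𝐄_q`: either (unitary case) the field
with `q ^ 2` elements and the involution `x ↦ x ^ q`, or (linear case) `F × F` for the field `F`
with `q` elements, with the involution that exchanges the two factors. -/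
def IsScalarRing.{u} (q : ℕ) (E : Type u) [CommRing E] [StarRing E] : Prop :=
  (IsField E ∧ Nat.card E = q ^ 2 ∧ ∀ x : E, star x = x ^ q) ∨
  ∃ (F : Type u) (_ : Field F) (e : E ≃+* F × F),
    Nat.card F = q ∧ ∀ x : E, e (star x) = (e x).swap

end Gassner

end

noncomputable section

namespace Gassner

/-! ### Fox Jacobians of arbitrary braids -/

section Jacobian

variable {E : Type*} [CommRing E] {n : ℕ}

/-! Write P for the product x_0 ⋯ x_n and W for the coordinate hyperplane. Braids on the strands 0,
…, n fix P, so they fix its vector v of Fox derivatives. The hypothesis t_0 ⋯ t_n = 1 says that the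
character of P is 1; this puts v in the reduced space, and v spans the radical of h on W
(`fullForm_radicalVector`, `eq_smul_radicalVector`).

Let z_i be the pure braid in which strand i goes around all the other strands of 0, …, n. On W it is
the scalar t_i modulo v (`foxJacobian_encircleBy`), so a commutator of two such braids acts on W as
a transvection along v. For z_i and z_{i+1} its functional is a unit times h(·, ε_i)
(`exists_actsBy_unit_smul_rootForm`). Conjugation by z_j multiplies the functional by t_j and
products add functionals; as the t_j generate E as a ring, every multiple c h(·, ε_i) occurs
(`exists_actsBy_smul_rootForm`).

The reduced space is W plus the line of one further vector x₀, with h(v, x₀) = 1. Braids acting on W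
as transvections along v form a Heisenberg-type group: the commutator of two of them is trivial on W
and moves x₀ by (φ(u) + star φ(u)) v, where φ is the functional of the first and u the displacement
of x₀ by the second (`ActsBy.commutator_apply`). A unitary transvection along v is determined by one
self-adjoint scalar. Since 2 is invertible that scalar is r + star r with r self-adjoint, and since
ε_0 and ε_1 are not orthogonal, functionals along these two roots can be chosen with φ(u) = r. -/

theorem foxJacobian_foxDeriv_comp (t : Fin (n + 1) → Eˣ) (β : BraidGroup n)
    (w : FreeGroup (Fin (n + 1))) :
    foxJacobian t β (foxDeriv (fun k => t (strandPerm n β k)) w) =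
      foxDeriv t (artinAction n β w) := by
  have hs : ∀ (u : Eˣ) (m : Fin (n + 1) → E), foxJacobian t β (u • m) =
      u • foxJacobian t β m := fun u m => map_smul _ (u : E) m
  induction w using FreeGroup.induction_on with
  | C1 => simp [foxDeriv_one]
  | of j => rw [foxDeriv_of, foxJacobian_single]
  | inv_of j h =>
    rw [foxDeriv_inv, map_inv, foxDeriv_inv, map_neg, hs, h, character_artin]
  | mul a b ha hb =>
    rw [foxDeriv_mul, map_mul, foxDeriv_mul, map_add, hs, ha, hb, character_artin]

/-- The chain rule of Fox calculus. The generators s_i are not pure, so the inner Jacobian is taken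
at permuted parameters; arguments by induction on braid words must therefore let t vary. -/
theorem foxJacobian_mul (t : Fin (n + 1) → Eˣ) (α β : BraidGroup n) (x : Fin (n + 1) → E) :
    foxJacobian t (α * β) x =
      foxJacobian t α (foxJacobian (fun k => t (strandPerm n α k)) β x) := by
  have : foxJacobian t (α * β) =
      (foxJacobian t α).comp (foxJacobian (fun k => t (strandPerm n α k)) β) := by
    refine (Pi.basisFun E (Fin (n + 1))).ext fun j => ?_
    simp only [Pi.basisFun_apply, foxJacobian_single, map_mul, MulAut.mul_apply,
      LinearMap.comp_apply, foxJacobian_foxDeriv_comp]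
  exact DFunLike.congr_fun this x

theorem foxJacobian_one (t : Fin (n + 1) → Eˣ) (x : Fin (n + 1) → E) :
    foxJacobian t (1 : BraidGroup n) x = x := by
  have : foxJacobian t (1 : BraidGroup n) = LinearMap.id := by
    refine (Pi.basisFun E (Fin (n + 1))).ext fun j => ?_
    simp only [Pi.basisFun_apply, foxJacobian_single, map_one, MulAut.one_apply, foxDeriv_of,
      LinearMap.id_apply]
  exact DFunLike.congr_fun this x

theorem foxJacobian_inv_apply (t : Fin (n + 1) → Eˣ) (β : BraidGroup n) (x : Fin (n + 1) → E) :
    foxJacobian (fun k => t (strandPerm n β⁻¹ k)) β (foxJacobian t β⁻¹ x) = x := by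
  have h := foxJacobian_mul (fun k => t (strandPerm n β⁻¹ k)) β β⁻¹ x
  simp only [mul_inv_cancel, foxJacobian_one] at h
  have e : (fun k => t (strandPerm n β⁻¹ (strandPerm n β k))) = t := by funext k; simp
  rw [e] at h
  exact h.symm

theorem foxJacobian_apply_inv (t : Fin (n + 1) → Eˣ) (β : BraidGroup n) (x : Fin (n + 1) → E) :
    foxJacobian t β (foxJacobian (fun k => t (strandPerm n β k)) β⁻¹ x) = x := by
  rw [← foxJacobian_mul, mul_inv_cancel, foxJacobian_one]

theorem artinAction_gen (i : Fin n) (k : Fin (n + 1)) :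
    artinAction n (PresentedGroup.of i) (.of k) = artinFun i k := by
  rw [artinAction, PresentedGroup.toGroup.of, artinAut_of]

theorem strandPerm_gen (i : Fin n) :
    strandPerm n (PresentedGroup.of i) = Equiv.swap i.castSucc i.succ := by
  rw [strandPerm, PresentedGroup.toGroup.of]

theorem foxDeriv_conj (t : Fin (n + 1) → Eˣ) (w : FreeGroup (Fin (n + 1))) (j : Fin (n + 1)) :
    foxDeriv t (w * .of j * w⁻¹) =
      (1 - (t j : E)) • foxDeriv t w + (character t w : E) • Pi.single j 1 := by
  have e : character t (.of j) = t j := by simp [character]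
  rw [foxDeriv_mul, foxDeriv_mul, foxDeriv_inv, foxDeriv_of, map_mul, e]
  simp only [Units.smul_def, Units.val_mul, smul_neg, smul_smul]
  rw [mul_right_comm, Units.mul_inv, one_mul]
  module

theorem foxJacobian_gen (t : Fin (n + 1) → Eˣ) (i : Fin n) (x : Fin (n + 1) → E) :
    foxJacobian t (PresentedGroup.of i) x = x +
      (x i.succ - (t i.succ : E) * x i.castSucc) • Pi.single i.castSucc 1 +
      ((t i.castSucc : E) * x i.castSucc - x i.succ) • Pi.single i.succ 1 := by
  have h : i.succ ≠ i.castSucc := by simp [Fin.ext_iff]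
  have : foxJacobian t (PresentedGroup.of i) = LinearMap.id +
      (LinearMap.toSpanSingleton E _ (Pi.single i.castSucc (1 : E))).comp
        (LinearMap.proj i.succ - (t i.succ : E) • LinearMap.proj i.castSucc) +
      (LinearMap.toSpanSingleton E _ (Pi.single i.succ (1 : E))).comp
        ((t i.castSucc : E) • LinearMap.proj i.castSucc - LinearMap.proj i.succ) := by
    refine (Pi.basisFun E (Fin (n + 1))).ext fun j => ?_
    simp only [Pi.basisFun_apply, foxJacobian_single, artinAction_gen, artinFun]
    split_ifs with h1 h2
    · subst h1
      rw [foxDeriv_conj, foxDeriv_of]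
      simp [h, character]
      module
    · subst h2
      rw [foxDeriv_of]
      simp [h.symm]
    · rw [foxDeriv_of]
      simp [Ne.symm h1, Ne.symm h2]
  rw [this]
  simp [LinearMap.toSpanSingleton_apply]

theorem foxJacobian_gen_apply (t : Fin (n + 1) → Eˣ) (i : Fin n) (x : Fin (n + 1) → E)
    (k : Fin (n + 1)) :
    foxJacobian t (PresentedGroup.of i) x k =
      if k = i.castSucc then x i.succ + (1 - (t i.succ : E)) * x i.castSucc
      else if k = i.succ then (t i.castSucc : E) * x i.castSucc else x k := by
  have h : i.succ ≠ i.castSucc := by simp [Fin.ext_iff]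
  rw [foxJacobian_gen]
  split_ifs with h1 h2
  · subst h1; simp [h.symm]; ring
  · subst h2; simp [h]
  · simp [h1, h2]

end Jacobian

/-! ### The form -/

section Form

variable {E : Type*} [CommRing E] {n : ℕ}

/-- The partial sum over the strands before `k` of the linear form `e_j ↦ 1 - t_j`. -/
def partialBoundary (t : Fin (n + 1) → Eˣ) (k : ℕ) (x : Fin (n + 1) → E) : E :=
  ∑ i ∈ Finset.univ.filter fun i : Fin (n + 1) => (i : ℕ) < k, (1 - (t i : E)) * x i

theorem partialBoundary_zero (t : Fin (n + 1) → Eˣ) (x : Fin (n + 1) → E) :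
    partialBoundary t 0 x = 0 := by simp [partialBoundary]

theorem partialBoundary_succ (t : Fin (n + 1) → Eˣ) (k : Fin (n + 1)) (x : Fin (n + 1) → E) :
    partialBoundary t (k + 1) x = partialBoundary t k x + (1 - (t k : E)) * x k := by
  have : (Finset.univ.filter fun i : Fin (n + 1) => (i : ℕ) < k + 1) =
      insert k (Finset.univ.filter fun i : Fin (n + 1) => (i : ℕ) < k) := by
    ext i; simp [Fin.ext_iff]; omega
  rw [partialBoundary, this, Finset.sum_insert (by simp), add_comm]; rfl

theorem partialBoundary_top (t : Fin (n + 1) → Eˣ) (x : Fin (n + 1) → E) :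
    partialBoundary t (n + 1) x = -boundary t x := by
  rw [partialBoundary, Finset.filter_true_of_mem fun i _ => i.2, boundary,
    Fintype.linearCombination_apply, ← Finset.sum_neg_distrib]
  refine Finset.sum_congr rfl fun i _ => ?_
  rw [smul_eq_mul]; ring

/-- The changes at strands i and i+1 are opposite, so only the partial sum that separates these two
strands receives a correction. -/
theorem partialBoundary_foxJacobian_gen (t : Fin (n + 1) → Eˣ) (i : Fin n)
    (x : Fin (n + 1) → E) (k : ℕ) :
    partialBoundary t k (foxJacobian t (PresentedGroup.of i) x) =
      partialBoundary (fun k => t (Equiv.swap i.castSucc i.succ k)) k x +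
        if k = i + 1 then (1 - (t i.castSucc : E)) * x i.succ -
          (t i.castSucc : E) * (1 - (t i.succ : E)) * x i.castSucc else 0 := by
  have h : i.succ ≠ i.castSucc := by simp [Fin.ext_iff]
  set d := (1 - (t i.castSucc : E)) * x i.succ -
    (t i.castSucc : E) * (1 - (t i.succ : E)) * x i.castSucc with hd
  have key : ∀ j, (1 - (t j : E)) * foxJacobian t (PresentedGroup.of i) x j =
      (1 - (t (Equiv.swap i.castSucc i.succ j) : E)) * x j +
        ((if j = i.castSucc then d else 0) - if j = i.succ then d else 0) := by
    intro j
    rw [foxJacobian_gen_apply]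
    by_cases h1 : j = i.castSucc
    · subst h1; simp [h.symm, hd]; ring
    · by_cases h2 : j = i.succ
      · subst h2; simp [h, hd]; ring
      · simp [h1, h2, Equiv.swap_apply_of_ne_of_ne h1 h2]
  simp only [partialBoundary, key, Finset.sum_add_distrib, Finset.sum_sub_distrib,
    Finset.sum_ite_eq', Finset.mem_filter, Finset.mem_univ, true_and, Fin.val_castSucc,
    Fin.val_succ]
  congr 1
  split_ifs <;> first | omega | simp

/-- The coefficients of the linear form `h(x, ·)` up to conjugation. -/
def dualCoeff (t : Fin (n + 1) → Eˣ) (x : Fin (n + 1) → E) (j : Fin (n + 1)) : E :=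
  x j + partialBoundary t j x

variable [StarRing E]

/-- The formula for the skew-Hermitian form on the whole of `E ^ (n + 1)`. -/
def fullForm (t : Fin (n + 1) → Eˣ) (x y : Fin (n + 1) → E) : E :=
  ∑ j, dualCoeff t x j * star ((1 - (t j : E)) * y j)

/-- Collecting terms by the index of y extends the form to all of E ^ (n + 1), where invariance can
be checked on one generator at a time. -/
theorem gassnerForm_eq (t : Fin (n + 1) → Eˣ) (x y : ReducedSpace t) :
    gassnerForm t x y = fullForm t x y := by
  rw [gassnerForm, fullForm, Finset.sum_comm' (t' := Finset.univ)
    (s' := fun j : Fin (n + 1) => Finset.univ.filter fun i : Fin (n + 1) => (i : ℕ) < j)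
    (by intro i j; simp), ← Finset.sum_add_distrib]
  refine Finset.sum_congr rfl fun j _ => ?_
  rw [dualCoeff, partialBoundary, add_mul, Finset.sum_mul, star_mul', star_sub, star_one]
  ring

theorem fullForm_add_left (t : Fin (n + 1) → Eˣ) (x y z : Fin (n + 1) → E) :
    fullForm t (x + y) z = fullForm t x z + fullForm t y z := by
  simp only [fullForm, dualCoeff, partialBoundary, Pi.add_apply,
    mul_add, Finset.sum_add_distrib]
  rw [← Finset.sum_add_distrib]
  refine Finset.sum_congr rfl fun j _ => ?_
  ring

theorem fullForm_smul_left (t : Fin (n + 1) → Eˣ) (c : E) (x z : Fin (n + 1) → E) :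
    fullForm t (c • x) z = c * fullForm t x z := by
  simp only [fullForm, Finset.mul_sum, dualCoeff, partialBoundary, Pi.smul_apply, smul_eq_mul]
  refine Finset.sum_congr rfl fun j _ => ?_
  rw [← mul_assoc, mul_add, Finset.mul_sum]
  simp only [mul_left_comm]

theorem fullForm_add_right (t : Fin (n + 1) → Eˣ) (x y z : Fin (n + 1) → E) :
    fullForm t x (y + z) = fullForm t x y + fullForm t x z := by
  simp only [fullForm, ← Finset.sum_add_distrib, Pi.add_apply, mul_add, star_add]

theorem fullForm_smul_right (t : Fin (n + 1) → Eˣ) (c : E) (x z : Fin (n + 1) → E) :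
    fullForm t x (c • z) = star c * fullForm t x z := by
  simp only [fullForm, Finset.mul_sum, Pi.smul_apply, smul_eq_mul, star_mul']
  refine Finset.sum_congr rfl fun j _ => ?_
  ring

/-- Away from strands i and i+1 the summands agree. The two remaining ones combine to a multiple of
t_i star t_i - 1. -/
theorem fullForm_foxJacobian_gen (t : Fin (n + 1) → Eˣ)
    (ht : ∀ i, star (t i : E) = ((t i)⁻¹ : Eˣ)) (i : Fin n) (x y : Fin (n + 1) → E) :
    fullForm t (foxJacobian t (PresentedGroup.of i) x) (foxJacobian t (PresentedGroup.of i) y) =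
      fullForm (fun k => t (Equiv.swap i.castSucc i.succ k)) x y := by
  have h : i.succ ≠ i.castSucc := by simp [Fin.ext_iff]
  rw [← sub_eq_zero, fullForm, fullForm, ← Finset.sum_sub_distrib,
    Fintype.sum_eq_add i.castSucc i.succ h.symm]
  · have hp := partialBoundary_succ (fun k => t (Equiv.swap i.castSucc i.succ k)) i.castSucc x
    have h1 : (t i.castSucc : E) * star (t i.castSucc : E) = 1 := by rw [ht, Units.mul_inv]
    simp only [Fin.val_castSucc, Equiv.swap_apply_left] at hp
    simp only [dualCoeff, partialBoundary_foxJacobian_gen, foxJacobian_gen_apply, h,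
      Fin.val_castSucc, Fin.val_succ, hp, if_true, if_false, Equiv.swap_apply_left,
      Equiv.swap_apply_right, star_mul', star_add, star_sub, star_one]
    simp only [show ¬ ((i : ℕ) = i + 1) by omega, if_false, add_zero]
    linear_combination ((t i.succ : E) * x i.castSucc - x i.succ) *
      (1 - star (t i.succ : E)) * star (y i.castSucc) * h1
  · rintro j ⟨h1, h2⟩
    have h3 : ¬ ((j : ℕ) = i + 1) := fun e => h2 (Fin.ext (by simp [e]))
    simp [dualCoeff, partialBoundary_foxJacobian_gen, foxJacobian_gen_apply, h1, h2, h3,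
      Equiv.swap_apply_of_ne_of_ne h1 h2]

end Form

/-! ### The boundary form under arbitrary braids. -/

section Boundary

variable {E : Type*} [CommRing E] {n : ℕ}

theorem boundary_foxJacobian (t : Fin (n + 1) → Eˣ) (β : BraidGroup n) (x : Fin (n + 1) → E) :
    boundary t (foxJacobian t β x) = boundary (fun k => t (strandPerm n β k)) x := by
  have : (boundary t).comp (foxJacobian t β) = boundary (fun k => t (strandPerm n β k)) := by
    refine (Pi.basisFun E (Fin (n + 1))).ext fun j => ?_
    rw [LinearMap.comp_apply, Pi.basisFun_apply, foxJacobian_single, boundary_foxDeriv,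
      character_artin, ← boundary_foxDeriv, foxDeriv_of]
  exact DFunLike.congr_fun this x

end Boundary

/-! ### The product of the first free generators -/

section StrandProd

variable {n : ℕ}

/-- The product `x_0 ⋯ x_{k-1}` in the free group on `x_0, …, x_n`. -/
def strandProd (n : ℕ) : ℕ → FreeGroup (Fin (n + 1))
  | 0 => 1
  | k + 1 => strandProd n k * if h : k < n + 1 then .of ⟨k, h⟩ else 1

theorem strandProd_zero : strandProd n 0 = 1 := rfl

theorem strandProd_succ (k : Fin (n + 1)) :
    strandProd n (k + 1) = strandProd n k * .of k := by
  simp [strandProd, Nat.le_of_lt_succ k.2]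

theorem artinAction_gen_strandProd_of_le (i : Fin n) (k : ℕ) (h : k ≤ i) :
    artinAction n (PresentedGroup.of i) (strandProd n k) = strandProd n k := by
  induction k with
  | zero => rw [strandProd_zero, map_one]
  | succ k ih =>
    have e := strandProd_succ (n := n) ⟨k, by omega⟩
    simp only at e
    rw [e, map_mul, ih (by omega), artinAction_gen, artinFun,
      if_neg (by simp [Fin.ext_iff]; omega), if_neg (by simp [Fin.ext_iff]; omega)]

theorem artinAction_gen_strandProd_add_two (i : Fin n) :
    artinAction n (PresentedGroup.of i) (strandProd n (i + 2)) = strandProd n (i + 2) := by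
  have h : i.succ ≠ i.castSucc := by simp [Fin.ext_iff]
  have e1 := strandProd_succ i.castSucc
  have e2 := strandProd_succ i.succ
  simp only [Fin.val_castSucc, Fin.val_succ] at e1 e2
  rw [e2, e1]
  simp [artinAction_gen_strandProd_of_le i i le_rfl, artinAction_gen, artinFun, h, mul_assoc]

/-- The product x_i x_{i+1} is fixed by s_i, and only for k = i + 1 does the prefix contain x_i
without x_{i+1}. -/
theorem artinAction_gen_strandProd (i : Fin n) (k : ℕ) (hk : k ≤ n + 1) (h : k ≠ i + 1) :
    artinAction n (PresentedGroup.of i) (strandProd n k) = strandProd n k := by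
  rcases lt_or_gt_of_ne h with h | h
  · exact artinAction_gen_strandProd_of_le i k (by omega)
  · induction k, (show (i : ℕ) + 2 ≤ k from h) using Nat.le_induction with
    | base => exact artinAction_gen_strandProd_add_two i
    | succ k hle ih =>
      have e := strandProd_succ (n := n) ⟨k, by omega⟩
      simp only at e
      rw [e, map_mul, ih (by omega) (by omega) (by omega), artinAction_gen, artinFun,
        if_neg (by simp [Fin.ext_iff]; omega), if_neg (by simp [Fin.ext_iff]; omega)]

variable {E : Type*} [CommRing E]

theorem character_strandProd_succ (t : Fin (n + 1) → Eˣ) (k : Fin (n + 1)) :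
    character t (strandProd n (k + 1)) = character t (strandProd n k) * t k := by
  rw [strandProd_succ, map_mul]; simp [character]

theorem foxDeriv_strandProd (t : Fin (n + 1) → Eˣ) (k : ℕ) (hk : k ≤ n + 1) (j : Fin (n + 1)) :
    foxDeriv t (strandProd n k) j =
      if (j : ℕ) < k then (character t (strandProd n j) : E) else 0 := by
  induction k with
  | zero => simp [strandProd_zero, foxDeriv_one]
  | succ k ih =>
    have e := strandProd_succ (n := n) ⟨k, by omega⟩
    simp only at e
    rw [e, foxDeriv_mul, foxDeriv_of, Pi.add_apply, ih (by omega)]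
    rcases lt_trichotomy (j : ℕ) k with h | h | h
    · have : j ≠ ⟨k, by omega⟩ := by simp [Fin.ext_iff]; omega
      simp [h, this, Nat.lt_succ_of_lt h]
    · subst h
      simp [Units.smul_def]
    · have : j ≠ ⟨k, by omega⟩ := by simp [Fin.ext_iff]; omega
      simp [this, not_lt.2 h.le, show ¬ (j : ℕ) < k + 1 by omega]

theorem character_strandProd (t : Fin (n + 2) → Eˣ) :
    character t (strandProd (n + 1) (n + 1)) = ∏ i : Fin (n + 1), t i.castSucc := by
  have : ∀ k (hk : k ≤ n + 2), character t (strandProd (n + 1) k) =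
      ∏ i : Fin k, t (Fin.castLE hk i) := by
    intro k hk
    induction k with
    | zero => simp [strandProd_zero]
    | succ k ih =>
      have e := character_strandProd_succ t ⟨k, by omega⟩
      simp only at e
      rw [e, ih (by omega), Fin.prod_univ_castSucc]
      rfl
  exact this (n + 1) (by omega)

end StrandProd

/-! ### The braid in which one strand encircles the others -/

section Encircle

variable {n : ℕ}

/-- The generator `s_k`, or `1` if there is none. -/
def gen (n k : ℕ) : BraidGroup n := if h : k < n then PresentedGroup.of ⟨k, h⟩ else 1

/-- The braid `s_0 s_1 ⋯ s_{k-1}`. -/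
def ascending (n : ℕ) : ℕ → BraidGroup n
  | 0 => 1
  | k + 1 => ascending n k * gen n k

/-- The braid `s_{k-1} ⋯ s_1 s_0`. -/
def descending (n : ℕ) : ℕ → BraidGroup n
  | 0 => 1
  | k + 1 => gen n k * descending n k

theorem gen_of_lt {k : ℕ} (h : k < n) : gen n k = PresentedGroup.of ⟨k, h⟩ := dif_pos h

theorem artinAction_ascending_of_gt (k : ℕ) (j : Fin (n + 1)) (h : k < j) :
    artinAction n (ascending n k) (.of j) = .of j := by
  induction k with
  | zero => simp [ascending]
  | succ k ih =>
    rw [ascending, gen_of_lt (show k < n by omega), map_mul, MulAut.mul_apply, artinAction_gen,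
      artinFun, if_neg (by simp [Fin.ext_iff]; omega), if_neg (by simp [Fin.ext_iff]; omega),
      ih (by omega)]

theorem artinAction_ascending_self (k : ℕ) (hk : k < n + 1) :
    artinAction n (ascending n k) (.of ⟨k, hk⟩) = .of 0 := by
  induction k with
  | zero => simp [ascending]
  | succ k ih =>
    rw [ascending, gen_of_lt (show k < n by omega), map_mul, MulAut.mul_apply, artinAction_gen,
      artinFun, if_neg (by simp [Fin.ext_iff]), if_pos (by simp)]
    exact ih (by omega)

theorem artinAction_ascending_of_lt (k : ℕ) (hk : k ≤ n) (j : Fin n) (h : (j : ℕ) < k) :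
    artinAction n (ascending n k) (.of j.castSucc) = .of 0 * .of j.succ * (.of 0)⁻¹ := by
  induction k with
  | zero => omega
  | succ k ih =>
    rw [ascending, gen_of_lt (show k < n by omega), map_mul, MulAut.mul_apply, artinAction_gen,
      artinFun]
    rcases Nat.lt_succ_iff_lt_or_eq.1 h with h | h
    · rw [if_neg (by simp [Fin.ext_iff]; omega), if_neg (by simp [Fin.ext_iff]; omega),
        ih (by omega) h]
    · subst h
      have e : artinAction n (ascending n j) (.of j.castSucc) = .of 0 :=
        artinAction_ascending_self j (by omega)
      have e' := artinAction_ascending_of_gt j j.succ (by simp)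
      rw [if_pos rfl, map_mul, map_mul, map_inv]
      change artinAction n _ (.of j.castSucc) * artinAction n _ (.of j.succ) *
        (artinAction n _ (.of j.castSucc))⁻¹ = _
      rw [e, e']

theorem artinAction_ascending_strandProd (m k : ℕ) (hk : k ≤ n + 1) (h : m < k) :
    artinAction n (ascending n m) (strandProd n k) = strandProd n k := by
  induction m with
  | zero => simp [ascending]
  | succ m ih =>
    rw [ascending, gen_of_lt (show m < n by omega), map_mul, MulAut.mul_apply,
      artinAction_gen_strandProd _ _ hk (by simp; omega), ih (by omega)]

theorem artinAction_descending_of_gt (k : ℕ) (j : Fin (n + 1)) (h : k < j) :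
    artinAction n (descending n k) (.of j) = .of j := by
  induction k with
  | zero => simp [descending]
  | succ k ih =>
    rw [descending, gen_of_lt (show k < n by omega), map_mul, MulAut.mul_apply, ih (by omega),
      artinAction_gen, artinFun, if_neg (by simp [Fin.ext_iff]; omega),
      if_neg (by simp [Fin.ext_iff]; omega)]

theorem artinAction_descending_succ (k : ℕ) (hk : k ≤ n) (j : Fin n) (h : (j : ℕ) < k) :
    artinAction n (descending n k) (.of j.succ) = .of j.castSucc := by
  induction k with
  | zero => omega
  | succ k ih =>
    rw [descending, gen_of_lt (show k < n by omega), map_mul, MulAut.mul_apply]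
    rcases Nat.lt_succ_iff_lt_or_eq.1 h with h | h
    · rw [ih (by omega) h, artinAction_gen, artinFun, if_neg (by simp [Fin.ext_iff]; omega),
        if_neg (by simp [Fin.ext_iff]; omega)]
    · subst h
      rw [artinAction_descending_of_gt _ _ (by simp), artinAction_gen, artinFun,
        if_neg (by simp [Fin.ext_iff]), if_pos rfl]

theorem artinAction_descending_zero (k : ℕ) (hk : k < n + 1) :
    artinAction n (descending n k) (.of 0) =
      strandProd n k * .of ⟨k, hk⟩ * (strandProd n k)⁻¹ := by
  induction k with
  | zero => simp [descending, strandProd_zero]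
  | succ k ih =>
    have e := strandProd_succ (n := n) ⟨k, by omega⟩
    simp only at e
    rw [descending, gen_of_lt (show k < n by omega), map_mul, MulAut.mul_apply, ih (by omega),
      map_mul, map_mul, map_inv, artinAction_gen_strandProd_of_le _ _ (by simp), artinAction_gen,
      artinFun, if_pos (by simp), e]
    simp [mul_assoc]

/-- The pure braid in which strand `0` encircles the strands `1, …, k`. -/
def encircle (n k : ℕ) : BraidGroup n := ascending n k * descending n k

theorem artinAction_encircle_zero (k : ℕ) (hk : k ≤ n) :
    artinAction n (encircle n k) (.of 0) =
      strandProd n (k + 1) * .of 0 * (strandProd n (k + 1))⁻¹ := by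
  have e := strandProd_succ (n := n) ⟨k, by omega⟩
  simp only at e
  -- The ascending half fixes the longer prefix, which contains x_k, but need not fix the shorter
  -- one.
  have e' : strandProd n k = strandProd n (k + 1) * (.of ⟨k, by omega⟩)⁻¹ := by rw [e]; group
  rw [encircle, map_mul, MulAut.mul_apply, artinAction_descending_zero k (by omega), e']
  simp only [map_mul, map_inv, artinAction_ascending_self,
    artinAction_ascending_strandProd k (k + 1) (Nat.succ_le_succ hk) (Nat.lt_succ_self k)]
  simp [mul_assoc]

theorem artinAction_encircle_succ (k : ℕ) (hk : k ≤ n) (j : Fin n) (h : (j : ℕ) < k) :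
    artinAction n (encircle n k) (.of j.succ) = .of 0 * .of j.succ * (.of 0)⁻¹ := by
  rw [encircle, map_mul, MulAut.mul_apply, artinAction_descending_succ k hk j h,
    artinAction_ascending_of_lt k hk j h]

theorem artinAction_encircle_of_gt (k : ℕ) (j : Fin (n + 1)) (h : k < j) :
    artinAction n (encircle n k) (.of j) = .of j := by
  rw [encircle, map_mul, MulAut.mul_apply, artinAction_descending_of_gt k j h,
    artinAction_ascending_of_gt k j h]

/-- The word s_0 ⋯ s_{k-1} s_{k-1} ⋯ s_0 is a palindrome, so its transpositions cancel from the
middle outwards. -/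
theorem strandPerm_encircle (k : ℕ) : strandPerm n (encircle n k) = 1 := by
  induction k with
  | zero => simp [encircle, ascending, descending]
  | succ k ih =>
    have h : strandPerm n (gen n k) * strandPerm n (gen n k) = 1 := by
      rw [gen]
      split_ifs with h
      · rw [strandPerm_gen, Equiv.swap_mul_self]
      · simp
    rw [encircle, map_mul] at ih ⊢
    rw [ascending, descending, map_mul, map_mul, mul_assoc, ← mul_assoc (strandPerm n (gen n k)),
      h, one_mul, ih]

/-- The conjugate of `encircle n k` in which strand `i` encircles the others. -/
def encircleBy (n k : ℕ) : ℕ → BraidGroup n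
  | 0 => encircle n k
  | i + 1 => gen n i * encircleBy n k i * (gen n i)⁻¹

theorem strandPerm_encircleBy (k i : ℕ) : strandPerm n (encircleBy n k i) = 1 := by
  induction i with
  | zero => exact strandPerm_encircle k
  | succ i ih => simp [encircleBy, ih]

theorem gen_mem (k : ℕ) (hk : k < n) : gen (n + 1) k ∈
    Subgroup.closure (Set.range fun i : Fin n =>
      (PresentedGroup.of i.castSucc : BraidGroup (n + 1))) := by
  rw [gen_of_lt (by omega)]
  exact Subgroup.subset_closure ⟨⟨k, hk⟩, rfl⟩

theorem encircleBy_mem (i : ℕ) (hi : i ≤ n) : encircleBy (n + 1) n i ∈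
    Subgroup.closure (Set.range fun i : Fin n =>
      (PresentedGroup.of i.castSucc : BraidGroup (n + 1))) := by
  induction i with
  | zero =>
    have h : ∀ k ≤ n, ascending (n + 1) k ∈ Subgroup.closure (Set.range fun i : Fin n =>
        (PresentedGroup.of i.castSucc : BraidGroup (n + 1))) ∧
        descending (n + 1) k ∈ Subgroup.closure (Set.range fun i : Fin n =>
        (PresentedGroup.of i.castSucc : BraidGroup (n + 1))) := by
      intro k hk
      induction k with
      | zero => exact ⟨one_mem _, one_mem _⟩
      | succ k ih =>
        have := ih (by omega)
        exact ⟨mul_mem this.1 (gen_mem k hk), mul_mem (gen_mem k hk) this.2⟩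
    exact mul_mem (h n le_rfl).1 (h n le_rfl).2
  | succ i ih =>
    exact mul_mem (mul_mem (gen_mem i hi) (ih (by omega))) (inv_mem (gen_mem i hi))

variable {E : Type*} [CommRing E]

/-- Conjugating x_j by x_0 scales e_j by t_0 and adds (1 - t_j) e_0; over a vector of the reduced
space the added terms combine through the boundary form. Conjugating x_0 by P, of character 1,
contributes only a multiple of the Fox vector of P. -/
theorem foxJacobian_encircle (t : Fin (n + 2) → Eˣ)
    (ht : character t (strandProd (n + 1) (n + 1)) = 1) (x : Fin (n + 2) → E)
    (hx : x (Fin.last _) = 0) (hb : boundary t x = 0) :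
    foxJacobian t (encircle (n + 1) n) x = (t 0 : E) • x +
      ((1 - (t 0 : E)) * x 0) • foxDeriv t (strandProd (n + 1) (n + 1)) := by
  -- On the whole space there are two correction terms, one through the boundary form and one
  -- through the last coordinate; both vanish at x.
  have : foxJacobian t (encircle (n + 1) n) = (t 0 : E) • LinearMap.id +
      (LinearMap.toSpanSingleton E _ (foxDeriv t (strandProd (n + 1) (n + 1)))).comp
        ((1 - (t 0 : E)) • LinearMap.proj 0) -
      (LinearMap.toSpanSingleton E _ (Pi.single 0 1)).comp (boundary t) +
      (LinearMap.toSpanSingleton E _ ((1 - (t 0 : E)) • Pi.single (Fin.last _) 1 +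
        ((t (Fin.last _) : E) - 1) • Pi.single 0 1)).comp (LinearMap.proj (Fin.last _)) := by
    have e0 : character t (.of 0) = t 0 := by simp [character]
    refine (Pi.basisFun E (Fin (n + 2))).ext fun j => ?_
    have hbd : boundary t (Pi.single j 1) = (t j : E) - 1 := by
      simp [boundary, Fintype.linearCombination_apply_single]
    simp only [Pi.basisFun_apply, foxJacobian_single, LinearMap.add_apply, LinearMap.sub_apply,
      LinearMap.comp_apply, LinearMap.smul_apply, LinearMap.id_apply, LinearMap.proj_apply, hbd,
      LinearMap.toSpanSingleton_apply]
    induction j using Fin.cases with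
    | zero =>
      have hl : Fin.last (n + 1) ≠ 0 := by simp
      rw [artinAction_encircle_zero n (by omega), foxDeriv_conj, ht]
      simp
      module
    | succ j =>
      have h0 : (0 : Fin (n + 2)) ≠ j.succ := (Fin.succ_ne_zero j).symm
      induction j using Fin.lastCases with
      | last =>
        rw [artinAction_encircle_of_gt n _ (by simp), foxDeriv_of]
        simp
      | cast j =>
        have hl : Fin.last (n + 1) ≠ j.castSucc.succ := by simp [Fin.ext_iff]; omega
        rw [artinAction_encircle_succ n (by omega) _ (by simp), foxDeriv_conj, foxDeriv_of, e0]
        simp [hl]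
        module
  rw [this]
  simp [hx, hb, LinearMap.toSpanSingleton_apply]

/-- Conjugation by s_i carries the formula from strand i to strand i+1, since s_i fixes P. The
coefficient is normalized so that the functional takes the value 1 - t_i on the Fox vector of P, as
it must because that vector is fixed. -/
theorem foxJacobian_encircleBy (i : Fin (n + 1)) (t : Fin (n + 2) → Eˣ)
    (ht : character t (strandProd (n + 1) (n + 1)) = 1) (x : Fin (n + 2) → E)
    (hx : x (Fin.last _) = 0) (hb : boundary t x = 0) :
    foxJacobian t (encircleBy (n + 1) n i) x = (t i.castSucc : E) • x +
      ((1 - (t i.castSucc : E)) * ((character t (strandProd (n + 1) i))⁻¹ : Eˣ) * x i.castSucc) •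
        foxDeriv t (strandProd (n + 1) (n + 1)) := by
  induction i using Fin.induction generalizing t x with
  | zero => simpa [strandProd_zero, encircleBy] using foxJacobian_encircle t ht x hx hb
  | succ i ih =>
    have hs : gen (n + 1) i = PresentedGroup.of i.castSucc := gen_of_lt _
    have hC : artinAction (n + 1) (PresentedGroup.of i.castSucc) (strandProd (n + 1) (n + 1)) =
        strandProd (n + 1) (n + 1) :=
      artinAction_gen_strandProd _ _ (by omega) (by simp; omega)
    set s : BraidGroup (n + 1) := PresentedGroup.of i.castSucc with hsdef
    set t' : Fin (n + 2) → Eˣ := fun k => t (strandPerm (n + 1) s k) with ht'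
    -- The induction hypothesis is applied to the preimage of x under s, at the parameters permuted
    -- by s.
    set y := foxJacobian t' s⁻¹ x with hy
    have hxy : foxJacobian t s y = x := foxJacobian_apply_inv t s x
    have hJ : foxJacobian t (encircleBy (n + 1) n (i.succ : Fin (n + 1))) x =
        foxJacobian t s (foxJacobian t' (encircleBy (n + 1) n i) y) := by
      rw [Fin.val_succ, encircleBy, hs, foxJacobian_mul, foxJacobian_mul]
      simp only [map_mul, strandPerm_encircleBy, mul_one]
      rfl
    have hyl : y (Fin.last _) = 0 := by
      rw [← hx, ← hxy, hsdef, foxJacobian_gen_apply, if_neg (by simp [Fin.ext_iff]; omega),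
        if_neg (by simp [Fin.ext_iff]; omega)]
    have hyb : boundary t' y = 0 := by rw [ht', ← boundary_foxJacobian, hxy, hb]
    have hyi : x i.succ.castSucc = (t i.castSucc.castSucc : E) * y i.castSucc.castSucc := by
      rw [← hxy, hsdef, foxJacobian_gen_apply, if_neg (by simp [Fin.ext_iff]),
        if_pos (by simp)]
    have ht1 : character t' (strandProd (n + 1) (n + 1)) = 1 := by
      rw [ht', ← character_artin, hC, ht]
    have hti : t' i.castSucc.castSucc = t i.succ.castSucc := by
      simp only [ht', hsdef, strandPerm_gen, Equiv.swap_apply_left]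
      rfl
    have hci : character t' (strandProd (n + 1) i) = character t (strandProd (n + 1) i) := by
      rw [ht', ← character_artin, artinAction_gen_strandProd_of_le _ _ (by simp)]
    have hcs := character_strandProd_succ t i.castSucc.castSucc
    have := ih t' ht1 y hyl hyb
    rw [hJ]
    simp only [Fin.val_castSucc, Fin.val_succ] at this hcs ⊢
    rw [this, map_add, map_smul, map_smul, hxy, ht', foxJacobian_foxDeriv_comp, hC, ← ht', hti,
      hci, hcs, hyi]
    congr 2
    rw [mul_inv, Units.val_mul]
    linear_combination -(1 - (t i.succ.castSucc : E)) *
      ((character t (strandProd (n + 1) i))⁻¹ : Eˣ) * y i.castSucc.castSucc *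
      Units.inv_mul (t i.castSucc.castSucc)

end Encircle

/-! ### Braids on the first strands -/

section FirstBraids

/-- The subgroup of the braid group on the strands `0, …, n + 1` generated by `s_0, …, s_{n-1}`. -/
abbrev firstBraids (n : ℕ) : Subgroup (BraidGroup (n + 1)) :=
  Subgroup.closure (Set.range fun i : Fin n =>
    (PresentedGroup.of i.castSucc : BraidGroup (n + 1)))

variable {E : Type*} [CommRing E] {n : ℕ}

theorem foxJacobian_apply_last {β : BraidGroup (n + 1)} (hβ : β ∈ firstBraids n) :
    ∀ (t : Fin (n + 2) → Eˣ) (x : Fin (n + 2) → E),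
      foxJacobian t β x (Fin.last _) = x (Fin.last _) := by
  induction hβ using Subgroup.closure_induction with
  | mem β h =>
    obtain ⟨i, rfl⟩ := h
    intro t x
    rw [foxJacobian_gen_apply, if_neg (by simp [Fin.ext_iff]; omega),
      if_neg (by simp [Fin.ext_iff]; omega)]
  | one => intro t x; rw [foxJacobian_one]
  | mul α β _ _ hα hβ => intro t x; rw [foxJacobian_mul, hα, hβ]
  | inv β _ h => intro t x; rw [← h _ (foxJacobian t β⁻¹ x), foxJacobian_inv_apply]

/-- Among the generators only s_n moves x_0 ⋯ x_n, and it is excluded here. -/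
theorem artinAction_strandProd_of_mem {β : BraidGroup (n + 1)} (hβ : β ∈ firstBraids n) :
    artinAction (n + 1) β (strandProd (n + 1) (n + 1)) = strandProd (n + 1) (n + 1) := by
  induction hβ using Subgroup.closure_induction with
  | mem β h =>
    obtain ⟨i, rfl⟩ := h
    exact artinAction_gen_strandProd _ _ (by omega) (by simp; omega)
  | one => rw [map_one, MulAut.one_apply]
  | mul α β _ _ hα hβ => rw [map_mul, MulAut.mul_apply, hβ, hα]
  | inv β _ h =>
    conv_lhs => rw [← h]
    rw [map_inv, MulAut.inv_apply_self]

theorem fullForm_foxJacobian [StarRing E] {β : BraidGroup (n + 1)} (hβ : β ∈ firstBraids n) :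
    ∀ (t : Fin (n + 2) → Eˣ) (_ : ∀ i, star (t i : E) = ((t i)⁻¹ : Eˣ)) (x y : Fin (n + 2) → E),
      fullForm t (foxJacobian t β x) (foxJacobian t β y) =
        fullForm (fun k => t (strandPerm (n + 1) β k)) x y := by
  induction hβ using Subgroup.closure_induction with
  | mem β h =>
    obtain ⟨i, rfl⟩ := h
    intro t ht x y
    rw [fullForm_foxJacobian_gen t ht, strandPerm_gen]
  | one => intro t ht x y; rw [foxJacobian_one, foxJacobian_one, map_one]; rfl
  | mul α β _ _ hα hβ =>
    intro t ht x y
    rw [foxJacobian_mul, foxJacobian_mul, hα t ht, hβ _ fun i => ht _, map_mul]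
    rfl
  | inv β _ h =>
    intro t ht x y
    have e := h (fun k => t (strandPerm (n + 1) β⁻¹ k)) (fun i => ht _) (foxJacobian t β⁻¹ x)
      (foxJacobian t β⁻¹ y)
    rw [foxJacobian_inv_apply, foxJacobian_inv_apply] at e
    rw [e]
    congr 1
    funext k
    simp

end FirstBraids

/-! ### The radical vector -/

section Radical

variable {E : Type*} [CommRing E] {n : ℕ}

/-- The vector of Fox derivatives of `x_0 ⋯ x_n` on the strands `0, …, n + 1`. -/
def radicalVector (t : Fin (n + 2) → Eˣ) : Fin (n + 2) → E :=
  foxDeriv t (strandProd (n + 1) (n + 1))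

theorem radicalVector_apply (t : Fin (n + 2) → Eˣ) (j : Fin (n + 2)) :
    radicalVector t j =
      if (j : ℕ) < n + 1 then (character t (strandProd (n + 1) j) : E) else 0 :=
  foxDeriv_strandProd t _ (by omega) j

theorem radicalVector_zero (t : Fin (n + 2) → Eˣ) : radicalVector t 0 = 1 := by
  simp [radicalVector_apply, strandProd_zero]

theorem radicalVector_last (t : Fin (n + 2) → Eˣ) : radicalVector t (Fin.last _) = 0 := by
  simp [radicalVector_apply]

theorem boundary_radicalVector (t : Fin (n + 2) → Eˣ)
    (ht : character t (strandProd (n + 1) (n + 1)) = 1) : boundary t (radicalVector t) = 0 := by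
  rw [radicalVector, boundary_foxDeriv, ht, Units.val_one, sub_self]

theorem partialBoundary_radicalVector (t : Fin (n + 2) → Eˣ) (k : ℕ) (hk : k ≤ n + 1) :
    partialBoundary t k (radicalVector t) = 1 - (character t (strandProd (n + 1) k) : E) := by
  induction k with
  | zero => simp [partialBoundary_zero, strandProd_zero]
  | succ k ih =>
    have e := partialBoundary_succ t ⟨k, by omega⟩ (radicalVector t)
    have e' := character_strandProd_succ t ⟨k, by omega⟩
    simp only at e e'
    rw [e, e', ih (by omega), radicalVector_apply, if_pos (by simp; omega), Units.val_mul]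
    ring

/-- The coordinates of v are the characters of the prefixes of P, and the partial boundaries
telescope to 1 minus the same characters. -/
theorem dualCoeff_radicalVector (t : Fin (n + 2) → Eˣ)
    (ht : character t (strandProd (n + 1) (n + 1)) = 1) (j : Fin (n + 2)) :
    dualCoeff t (radicalVector t) j = if (j : ℕ) < n + 1 then 1 else 0 := by
  rw [dualCoeff, partialBoundary_radicalVector t j (by omega), radicalVector_apply]
  split_ifs with h
  · ring
  · rw [show (j : ℕ) = n + 1 by omega, ht]; simp

/-- The vector `ε_i = (1 - t_i)⁻¹ e_i - (1 - t_{i+1})⁻¹ e_{i+1}`. -/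
def simpleVector (t : Fin (n + 1) → Eˣ) (i : Fin n) : Fin (n + 1) → E :=
  Pi.single i.castSucc (Ring.inverse (1 - (t i.castSucc : E))) -
    Pi.single i.succ (Ring.inverse (1 - (t i.succ : E)))

theorem mul_simpleVector (t : Fin (n + 1) → Eˣ) (h1 : ∀ i, IsUnit (1 - (t i : E))) (i : Fin n)
    (j : Fin (n + 1)) : (1 - (t j : E)) * simpleVector t i j =
      (if j = i.castSucc then 1 else 0) - if j = i.succ then 1 else 0 := by
  have h : i.succ ≠ i.castSucc := by simp [Fin.ext_iff]
  rw [simpleVector, Pi.sub_apply]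
  by_cases e1 : j = i.castSucc
  · subst e1; simp [h.symm, Ring.mul_inverse_cancel _ (h1 _)]
  · by_cases e2 : j = i.succ
    · subst e2; simp [h, Ring.mul_inverse_cancel _ (h1 _)]
    · simp [e1, e2]

theorem boundary_simpleVector (t : Fin (n + 1) → Eˣ) (h1 : ∀ i, IsUnit (1 - (t i : E)))
    (i : Fin n) : boundary t (simpleVector t i) = 0 := by
  rw [← neg_eq_zero, ← partialBoundary_top, partialBoundary]
  simp only [mul_simpleVector t h1, Finset.filter_true_of_mem fun (i : Fin (n + 1)) _ => i.2]
  simp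

variable [StarRing E]

/-- Pairing with ε_i takes the difference of the dual coefficients at i and i+1. -/
theorem fullForm_simpleVector (t : Fin (n + 1) → Eˣ) (h1 : ∀ i, IsUnit (1 - (t i : E)))
    (x : Fin (n + 1) → E) (i : Fin n) :
    fullForm t x (simpleVector t i) = (t i.castSucc : E) * x i.castSucc - x i.succ := by
  have hp := partialBoundary_succ t i.castSucc x
  simp only [Fin.val_castSucc] at hp
  have : ∀ j, dualCoeff t x j * star ((1 - (t j : E)) * simpleVector t i j) =
      (if j = i.castSucc then dualCoeff t x j else 0) -
        if j = i.succ then dualCoeff t x j else 0 := by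
    intro j
    rw [mul_simpleVector t h1]
    split_ifs <;> simp
  simp only [fullForm, this, Finset.sum_sub_distrib, Finset.sum_ite_eq', Finset.mem_univ, if_true]
  simp only [dualCoeff, Fin.val_castSucc, Fin.val_succ, hp]
  ring

/-- All dual coefficients of v on the first strands are 1, so pairing with v conjugates the partial
boundary of y there. As the full boundary of y vanishes, only the last strand counts; in particular
v is orthogonal to W. -/
theorem fullForm_radicalVector (t : Fin (n + 2) → Eˣ)
    (ht : character t (strandProd (n + 1) (n + 1)) = 1) (y : Fin (n + 2) → E)
    (hy : boundary t y = 0) :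
    fullForm t (radicalVector t) y =
      -star ((1 - (t (Fin.last _) : E)) * y (Fin.last _)) := by
  have e := partialBoundary_succ t (Fin.last (n + 1)) y
  rw [Fin.val_last, partialBoundary_top, hy, neg_zero] at e
  have : fullForm t (radicalVector t) y = star (partialBoundary t (n + 1) y) := by
    rw [fullForm, partialBoundary, star_sum, Finset.sum_filter]
    refine Finset.sum_congr rfl fun j _ => ?_
    rw [dualCoeff_radicalVector t ht]
    split_ifs <;> simp
  rw [this, ← star_neg, eq_neg_of_add_eq_zero_left e.symm]

theorem fullForm_skew (t : Fin (n + 1) → Eˣ) (ht : ∀ i, star (t i : E) = ((t i)⁻¹ : Eˣ))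
    (x y : Fin (n + 1) → E) (hx : boundary t x = 0) :
    fullForm t x y = -star (fullForm t y x) := by
  rw [eq_neg_iff_add_eq_zero]
  -- The symmetrized summands are the increments of F, so the sum telescopes; the top value vanishes
  -- because x has zero boundary.
  set F : ℕ → E := fun k => partialBoundary t k x * star (partialBoundary t k y) with hF
  have key : ∀ j : Fin (n + 1), dualCoeff t x j * star ((1 - (t j : E)) * y j) +
      star (dualCoeff t y j * star ((1 - (t j : E)) * x j)) = F (j + 1) - F j := by
    intro j
    have h1 : (t j : E) * star (t j : E) = 1 := by rw [ht, Units.mul_inv]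
    simp only [hF, partialBoundary_succ, dualCoeff, star_mul', star_add, star_sub, star_one,
      star_star]
    linear_combination -(x j * star (y j)) * h1
  rw [fullForm, fullForm, star_sum, ← Finset.sum_add_distrib, Finset.sum_congr rfl fun j _ => key j,
    Fin.sum_univ_eq_sum_range (fun k => F (k + 1) - F k), Finset.sum_range_sub]
  simp [hF, partialBoundary_top, partialBoundary_zero, hx]

/-- Orthogonality to ε_i is the recursion w_{i+1} = t_i w_i, which the prefix characters also
satisfy. -/
theorem eq_smul_radicalVector (t : Fin (n + 2) → Eˣ) (h1 : ∀ i, IsUnit (1 - (t i : E)))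
    (w : Fin (n + 2) → E) (hw : w (Fin.last _) = 0)
    (h : ∀ i : Fin n, fullForm t w (simpleVector t i.castSucc) = 0) :
    w = w 0 • radicalVector t := by
  have key : ∀ k (hk : k < n + 1), w ⟨k, by omega⟩ =
      w 0 * (character t (strandProd (n + 1) k) : E) := by
    intro k hk
    induction k with
    | zero => simp [strandProd_zero]
    | succ k ih =>
      have e := h ⟨k, by omega⟩
      have e' := character_strandProd_succ t ⟨k, by omega⟩
      simp only at e'
      rw [fullForm_simpleVector t h1, sub_eq_zero] at e
      simp only [Fin.castSucc_mk, Fin.succ_mk] at e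
      rw [← e, ih (by omega), e', Units.val_mul]
      ring
  funext j
  rw [Pi.smul_apply, radicalVector_apply, smul_eq_mul]
  split_ifs with hj
  · exact key j hj
  · rw [mul_zero, ← hw]
    exact congrArg w (Fin.ext (by simp; omega))

end Radical

/-! ### Transvections along the radical vector -/

section Transvections

variable {E : Type*} [CommRing E] {n : ℕ}

theorem gassner_apply (t : Fin (n + 1) → Eˣ) (a : PureBraidGroup n) (x : Fin (n + 1) → E) :
    gassner t a x = foxJacobian t (a : BraidGroup n) x := rfl

theorem gassner_inv_apply (t : Fin (n + 1) → Eˣ) (a : PureBraidGroup n) (x : Fin (n + 1) → E) :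
    gassner t a⁻¹ (gassner t a x) = x := by
  rw [← Module.End.mul_apply, ← map_mul, inv_mul_cancel, map_one, Module.End.one_apply]

theorem gassner_apply_inv (t : Fin (n + 1) → Eˣ) (a : PureBraidGroup n) (x : Fin (n + 1) → E) :
    gassner t a (gassner t a⁻¹ x) = x := by
  rw [← Module.End.mul_apply, ← map_mul, mul_inv_cancel, map_one, Module.End.one_apply]

theorem gassner_apply_last (t : Fin (n + 2) → Eˣ) {a : PureBraidGroup (n + 1)}
    (ha : a ∈ firstStrands n) (x : Fin (n + 2) → E) :
    gassner t a x (Fin.last _) = x (Fin.last _) :=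
  foxJacobian_apply_last (Subgroup.mem_subgroupOf.1 ha) t x

theorem gassner_radicalVector (t : Fin (n + 2) → Eˣ) {a : PureBraidGroup (n + 1)}
    (ha : a ∈ firstStrands n) : gassner t a (radicalVector t) = radicalVector t := by
  rw [radicalVector, gassner_apply, foxJacobian_foxDeriv,
    artinAction_strandProd_of_mem (Subgroup.mem_subgroupOf.1 ha)]

theorem fullForm_gassner [StarRing E] (t : Fin (n + 2) → Eˣ)
    (ht : ∀ i, star (t i : E) = ((t i)⁻¹ : Eˣ)) {a : PureBraidGroup (n + 1)}
    (ha : a ∈ firstStrands n) (x y : Fin (n + 2) → E) :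
    fullForm t (gassner t a x) (gassner t a y) = fullForm t x y := by
  rw [gassner_apply, gassner_apply, fullForm_foxJacobian (Subgroup.mem_subgroupOf.1 ha) t ht,
    show strandPerm (n + 1) a = 1 from a.2]
  rfl

/-- On the vectors of the reduced space that do not involve the last strand, the braid `a` on the
first strands acts as `w ↦ α w + f(w) v`, where `v` is the radical vector. -/
def ActsBy (t : Fin (n + 2) → Eˣ) (a : PureBraidGroup (n + 1)) (α : E)
    (f : (Fin (n + 2) → E) →ₗ[E] E) : Prop :=
  a ∈ firstStrands n ∧ ∀ w, boundary t w = 0 → w (Fin.last _) = 0 →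
    gassner t a w = α • w + f w • radicalVector t

/-- Both ab and ba are αβ modulo v, and ab - ba sends y to ((β - 1) f(y) - (α - 1) g(y)) v. This
functional kills v, so passing from y to w = ba y only multiplies it by αβ, whence the inverse
factor. -/
theorem ActsBy.commutator {t : Fin (n + 2) → Eˣ}
    {a b : PureBraidGroup (n + 1)} {α β : Eˣ} {f g : (Fin (n + 2) → E) →ₗ[E] E}
    (ha : ActsBy t a α f) (hb : ActsBy t b β g) (hf : f (radicalVector t) = 1 - α)
    (hg : g (radicalVector t) = 1 - β) :
    ActsBy t (a * b * a⁻¹ * b⁻¹) 1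
      (((α⁻¹ * β⁻¹ : Eˣ) : E) • (((β : E) - 1) • f - ((α : E) - 1) • g)) := by
  refine ⟨mul_mem (mul_mem (mul_mem ha.1 hb.1) (inv_mem ha.1)) (inv_mem hb.1),
    fun w hw hl => ?_⟩
  set v := radicalVector t
  have hba : b * a ∈ firstStrands n := mul_mem hb.1 ha.1
  obtain ⟨y, rfl⟩ : ∃ y, gassner t (b * a) y = w := ⟨_, gassner_apply_inv t (b * a) w⟩
  rw [boundary_gassner] at hw
  rw [gassner_apply_last t hba] at hl
  have e1 : gassner t (a * b) y = ((α : E) * β) • y + ((β : E) * f y + g y) • v := by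
    rw [map_mul, Module.End.mul_apply, hb.2 y hw hl, map_add, map_smul, map_smul, ha.2 y hw hl,
      gassner_radicalVector t ha.1]
    module
  have e2 : gassner t (b * a) y = ((α : E) * β) • y + ((α : E) * g y + f y) • v := by
    rw [map_mul, Module.End.mul_apply, ha.2 y hw hl, map_add, map_smul, map_smul, hb.2 y hw hl,
      gassner_radicalVector t hb.1]
    module
  have e3 : gassner t (a * b * a⁻¹ * b⁻¹) (gassner t (b * a) y) = gassner t (a * b) y := by
    rw [← Module.End.mul_apply, ← map_mul]
    congr 2
    group
  have e4 : (((α⁻¹ * β⁻¹ : Eˣ) : E) * ((α : E) * β)) = 1 := by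
    rw [← Units.val_mul, ← Units.val_mul, mul_mul_mul_comm, inv_mul_cancel, inv_mul_cancel,
      one_mul, Units.val_one]
  rw [e3, e1, e2]
  simp only [LinearMap.smul_apply, LinearMap.sub_apply, map_add, map_smul, hf, hg, smul_eq_mul]
  generalize ((α⁻¹ * β⁻¹ : Eˣ) : E) = γ at *
  have e5 : (α : E) * β * (γ * (((β : E) - 1) * f y - ((α : E) - 1) * g y)) +
      ((α : E) * g y + f y) * (γ * (((β : E) - 1) * (1 - α) - ((α : E) - 1) * (1 - β))) =
        ((β : E) - 1) * f y - ((α : E) - 1) * g y := by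
    linear_combination (((β : E) - 1) * f y - ((α : E) - 1) * g y) * e4
  rw [e5]
  module

/-- Since φ kills v, composing it with z multiplies it by α, while z⁻¹ fixes v. -/
theorem ActsBy.conj {t : Fin (n + 2) → Eˣ} {a z : PureBraidGroup (n + 1)} {α : E}
    {φ f : (Fin (n + 2) → E) →ₗ[E] E} (ha : ActsBy t a 1 φ) (hz : ActsBy t z α f)
    (hφ : φ (radicalVector t) = 0) : ActsBy t (z⁻¹ * a * z) 1 (α • φ) := by
  refine ⟨mul_mem (mul_mem (inv_mem hz.1) ha.1) hz.1, fun w hw hl => ?_⟩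
  have e : gassner t a (gassner t z w) = gassner t z w + (α * φ w) • radicalVector t := by
    rw [ha.2 _ (by rw [boundary_gassner, hw]) (by rw [gassner_apply_last t hz.1, hl]), one_smul]
    congr 2
    rw [hz.2 w hw hl, map_add, map_smul, map_smul, hφ]
    simp
  rw [map_mul, map_mul, Module.End.mul_apply, Module.End.mul_apply, e, map_add, map_smul,
    gassner_inv_apply, gassner_radicalVector t (inv_mem hz.1)]
  simp

theorem ActsBy.mul {t : Fin (n + 2) → Eˣ} {a b : PureBraidGroup (n + 1)}
    {φ ψ : (Fin (n + 2) → E) →ₗ[E] E} (ha : ActsBy t a 1 φ) (hb : ActsBy t b 1 ψ) :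
    ActsBy t (a * b) 1 (φ + ψ) := by
  refine ⟨mul_mem ha.1 hb.1, fun w hw hl => ?_⟩
  rw [map_mul, Module.End.mul_apply, hb.2 w hw hl, map_add, map_smul, map_smul, ha.2 w hw hl,
    gassner_radicalVector t ha.1, LinearMap.add_apply]
  module

theorem ActsBy.inv {t : Fin (n + 2) → Eˣ} {a : PureBraidGroup (n + 1)}
    {φ : (Fin (n + 2) → E) →ₗ[E] E} (ha : ActsBy t a 1 φ) : ActsBy t a⁻¹ 1 (-φ) := by
  refine ⟨inv_mem ha.1, fun w hw hl => ?_⟩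
  have e := congrArg (gassner t a⁻¹) (ha.2 w hw hl)
  rw [gassner_inv_apply, map_add, map_smul, map_smul, gassner_radicalVector t (inv_mem ha.1)] at e
  rw [one_smul] at e
  rw [eq_sub_of_add_eq e.symm, LinearMap.neg_apply]
  module

theorem ActsBy.one (t : Fin (n + 2) → Eˣ) : ActsBy t 1 1 0 :=
  ⟨one_mem _, fun w _ _ => by rw [map_one]; simp⟩

theorem exists_actsBy_scalar (t : Fin (n + 2) → Eˣ)
    (ht : character t (strandProd (n + 1) (n + 1)) = 1) (i : Fin (n + 1)) :
    ∃ z, ActsBy t z (t i.castSucc) (((1 - (t i.castSucc : E)) *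
      ((character t (strandProd (n + 1) i))⁻¹ : Eˣ)) • LinearMap.proj i.castSucc) := by
  refine ⟨⟨encircleBy (n + 1) n i, strandPerm_encircleBy n i⟩,
    Subgroup.mem_subgroupOf.2 (encircleBy_mem (i : ℕ) (by omega)), fun w hw hl => ?_⟩
  exact foxJacobian_encircleBy i t ht w hl hw

/-- The linear form `x ↦ t_i x_i - x_{i+1}`, which is `h(·, ε_i)`. -/
def rootForm (t : Fin (n + 1) → Eˣ) (i : Fin n) : (Fin (n + 1) → E) →ₗ[E] E :=
  (t i.castSucc : E) • LinearMap.proj i.castSucc - LinearMap.proj i.succ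

theorem rootForm_apply (t : Fin (n + 1) → Eˣ) (i : Fin n) (x : Fin (n + 1) → E) :
    rootForm t i x = (t i.castSucc : E) * x i.castSucc - x i.succ := rfl

theorem rootForm_radicalVector (t : Fin (n + 2) → Eˣ) (i : Fin n) :
    rootForm t i.castSucc (radicalVector t) = 0 := by
  have e := character_strandProd_succ t i.castSucc.castSucc
  simp only [Fin.val_castSucc] at e
  rw [rootForm_apply, radicalVector_apply, radicalVector_apply, if_pos (by simp),
    if_pos (by simp)]
  simp only [Fin.val_castSucc, Fin.val_succ, e, Units.val_mul]
  ring

theorem exists_actsBy_unit_smul_rootForm (t : Fin (n + 2) → Eˣ)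
    (h1 : ∀ i, IsUnit (1 - (t i : E)))
    (ht : character t (strandProd (n + 1) (n + 1)) = 1) (i : Fin n) :
    ∃ (κ : Eˣ) (a : _), ActsBy t a 1 ((κ : E) • rootForm t i.castSucc) := by
  obtain ⟨a, ha⟩ := exists_actsBy_scalar t ht i.castSucc
  obtain ⟨b, hb⟩ := exists_actsBy_scalar t ht i.succ
  obtain ⟨u, hu⟩ := h1 i.castSucc.castSucc
  obtain ⟨u', hu'⟩ := h1 i.succ.castSucc
  set τ := character t (strandProd (n + 1) i) with hτ
  set τ' := character t (strandProd (n + 1) i.succ) with hτ'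
  have e : τ' = τ * t i.castSucc.castSucc := character_strandProd_succ t i.castSucc.castSucc
  have hv : ∀ j : Fin (n + 1), ((1 - (t j.castSucc : E)) *
      ((character t (strandProd (n + 1) j))⁻¹ : Eˣ)) * radicalVector t j.castSucc =
        1 - t j.castSucc := by
    intro j
    rw [radicalVector_apply, if_pos (by exact j.2), Fin.val_castSucc, mul_assoc, Units.inv_mul, mul_one]
  -- The commutator formula leaves the common factor (1 - t_i)(1 - t_{i+1}) / (t_i t_{i+1}); the
  -- relation τ' = τ t_i turns the remaining difference into -τ'⁻¹ times the root form.
  refine ⟨-((t i.castSucc.castSucc)⁻¹ * (t i.succ.castSucc)⁻¹ * u * u' * τ'⁻¹), a * b * a⁻¹ * b⁻¹, ?_⟩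
  convert ha.commutator hb (hv _) (hv _) using 1
  refine LinearMap.ext fun x => ?_
  simp only [LinearMap.smul_apply, LinearMap.sub_apply, rootForm_apply, LinearMap.proj_apply,
    smul_eq_mul, Units.val_neg, Units.val_mul, hu, hu', Fin.val_castSucc, ← hτ]
  have e' : ((τ⁻¹ : Eˣ) : E) = t i.castSucc.castSucc * (τ'⁻¹ : Eˣ) := by
    rw [← Units.val_mul, e]; congr 1; simp
  rw [e', ← Fin.succ_castSucc]
  ring

theorem exists_actsBy_smul_rootForm (t : Fin (n + 2) → Eˣ) (h1 : ∀ i, IsUnit (1 - (t i : E)))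
    (ht : character t (strandProd (n + 1) (n + 1)) = 1)
    (hgen : Subring.closure (Set.range fun i : Fin (n + 1) => (t i.castSucc : E)) = ⊤)
    (i : Fin n) (c : E) : ∃ a, ActsBy t a 1 (c • rootForm t i.castSucc) := by
  -- The multipliers that preserve the set of realized coefficients form a subring containing each
  -- t_j. Quantifying over c inside makes closure under products immediate.
  have key : ∀ d ∈ Subring.closure (Set.range fun i : Fin (n + 1) => (t i.castSucc : E)),
      ∀ c, (∃ a, ActsBy t a 1 (c • rootForm t i.castSucc)) →
        ∃ a, ActsBy t a 1 ((d * c) • rootForm t i.castSucc) := by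
    intro d hd
    induction hd using Subring.closure_induction with
    | mem d h =>
      obtain ⟨j, rfl⟩ := h
      rintro c ⟨a, ha⟩
      obtain ⟨z, hz⟩ := exists_actsBy_scalar t ht j
      refine ⟨z⁻¹ * a * z, ?_⟩
      rw [mul_smul]
      exact ha.conj hz (by rw [LinearMap.smul_apply, rootForm_radicalVector, smul_zero])
    | zero => exact fun c _ => ⟨1, by rw [zero_mul, zero_smul]; exact ActsBy.one t⟩
    | one => exact fun c h => by rwa [one_mul]
    | add d d' _ _ hd hd' =>
      intro c h
      obtain ⟨a, ha⟩ := hd c h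
      obtain ⟨b, hb⟩ := hd' c h
      exact ⟨_, by rw [add_mul, add_smul]; exact ha.mul hb⟩
    | neg d _ hd =>
      intro c h
      obtain ⟨a, ha⟩ := hd c h
      refine ⟨a⁻¹, ?_⟩
      convert ha.inv using 1
      module
    | mul d d' _ _ hd hd' =>
      intro c h
      rw [mul_assoc]
      exact hd _ (hd' c h)
  obtain ⟨κ, a, ha⟩ := exists_actsBy_unit_smul_rootForm t h1 ht i
  have := key (c * (κ⁻¹ : Eˣ)) (by rw [hgen]; trivial) κ ⟨a, ha⟩
  rwa [mul_assoc, Units.inv_mul, mul_one] at this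

end Transvections

/-! ### Commutators of transvections -/

section Commutators

variable {E : Type*} [CommRing E] {n : ℕ}

theorem coe_reducedGassner (t : Fin (n + 1) → Eˣ) (a : PureBraidGroup n) (x : ReducedSpace t) :
    (((reducedGassner t a).1 x : ReducedSpace t) : Fin (n + 1) → E) = gassner t a x := rfl

/-- A vector of the reduced space whose last coordinate is a unit: `(1 - t_0)⁻¹ e_0 -
(1 - t_{n+1})⁻¹ e_{n+1}`. -/
def lastVector (t : Fin (n + 2) → Eˣ) : Fin (n + 2) → E :=
  Pi.single 0 (Ring.inverse (1 - (t 0 : E))) -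
    Pi.single (Fin.last _) (Ring.inverse (1 - (t (Fin.last _) : E)))

theorem mul_lastVector_last (t : Fin (n + 2) → Eˣ) (h1 : ∀ i, IsUnit (1 - (t i : E))) :
    (1 - (t (Fin.last _) : E)) * lastVector t (Fin.last _) = -1 := by
  simp [lastVector, Ring.mul_inverse_cancel _ (h1 _)]

theorem boundary_lastVector (t : Fin (n + 2) → Eˣ) (h1 : ∀ i, IsUnit (1 - (t i : E))) :
    boundary t (lastVector t) = 0 := by
  have h : ∀ j (c : E), boundary t (Pi.single j c) = -((1 - (t j : E)) * c) := by
    intro j c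
    rw [boundary, Fintype.linearCombination_apply_single, smul_eq_mul]
    ring
  rw [lastVector, map_sub, h, h, Ring.mul_inverse_cancel _ (h1 _), Ring.mul_inverse_cancel _ (h1 _),
    sub_self]

theorem eq_add_smul_lastVector (t : Fin (n + 2) → Eˣ) (h1 : ∀ i, IsUnit (1 - (t i : E)))
    (x : Fin (n + 2) → E) (hx : boundary t x = 0) :
    ∃ (w : Fin (n + 2) → E) (c : E), boundary t w = 0 ∧ w (Fin.last _) = 0 ∧
      x = w + c • lastVector t := by
  -- The coefficient is read off from the last coordinate.
  refine ⟨x - (-((1 - (t (Fin.last _) : E)) * x (Fin.last _))) • lastVector t, _, ?_, ?_,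
    (sub_add_cancel _ _).symm⟩
  · rw [map_sub, map_smul, hx, boundary_lastVector t h1, smul_zero, sub_zero]
  · rw [Pi.sub_apply, Pi.smul_apply, smul_eq_mul]
    linear_combination x (Fin.last _) * mul_lastVector_last t h1

theorem simpleVector_castSucc_last (t : Fin (n + 2) → Eˣ) (i : Fin n) :
    simpleVector t i.castSucc (Fin.last _) = 0 := by
  have h2 : Fin.last (n + 1) ≠ i.castSucc.succ := by simp [Fin.ext_iff]; omega
  rw [simpleVector, Pi.sub_apply, Pi.single_eq_of_ne (Fin.castSucc_lt_last _).ne',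
    Pi.single_eq_of_ne h2, sub_zero]

/-- Only strand j is shared, giving -t_j / (1 - t_j). This pairing of neighbouring roots makes the
final commutators nontrivial. -/
theorem isUnit_rootForm_simpleVector (t : Fin (n + 1) → Eˣ) (h1 : ∀ i, IsUnit (1 - (t i : E)))
    {i j : Fin n} (h : (i : ℕ) + 1 = j) : IsUnit (rootForm t j (simpleVector t i)) := by
  have e : i.succ = j.castSucc := Fin.ext h
  have e1 : j.castSucc ≠ i.castSucc := by simp [Fin.ext_iff]; omega
  have e2 : j.succ ≠ i.castSucc := by simp [Fin.ext_iff]; omega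
  have e3 : j.succ ≠ j.castSucc := by simp [Fin.ext_iff]
  rw [rootForm_apply, simpleVector, e, Pi.sub_apply, Pi.sub_apply, Pi.single_eq_of_ne e1,
    Pi.single_eq_of_ne e2, Pi.single_eq_of_ne e3, Pi.single_eq_same]
  simpa using h1 j.castSucc

variable [StarRing E]

theorem fullForm_radicalVector_lastVector (t : Fin (n + 2) → Eˣ)
    (h1 : ∀ i, IsUnit (1 - (t i : E))) (ht : character t (strandProd (n + 1) (n + 1)) = 1) :
    fullForm t (radicalVector t) (lastVector t) = 1 := by
  rw [fullForm_radicalVector t ht _ (boundary_lastVector t h1), mul_lastVector_last t h1]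
  simp

theorem fullForm_lastVector_radicalVector (t : Fin (n + 2) → Eˣ)
    (h1 : ∀ i, IsUnit (1 - (t i : E))) (hs : ∀ i, star (t i : E) = ((t i)⁻¹ : Eˣ))
    (ht : character t (strandProd (n + 1) (n + 1)) = 1) :
    fullForm t (lastVector t) (radicalVector t) = -1 := by
  rw [fullForm_skew t hs _ _ (boundary_lastVector t h1),
    fullForm_radicalVector_lastVector t h1 ht, star_one]

theorem fullForm_radicalVector_eq_zero (t : Fin (n + 2) → Eˣ)
    (ht : character t (strandProd (n + 1) (n + 1)) = 1) (y : Fin (n + 2) → E)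
    (hy : boundary t y = 0) (hl : y (Fin.last _) = 0) : fullForm t (radicalVector t) y = 0 := by
  rw [fullForm_radicalVector t ht y hy, hl]
  simp

theorem fullForm_radicalVector_right (t : Fin (n + 2) → Eˣ)
    (hs : ∀ i, star (t i : E) = ((t i)⁻¹ : Eˣ))
    (ht : character t (strandProd (n + 1) (n + 1)) = 1) (y : Fin (n + 2) → E)
    (hy : boundary t y = 0) (hl : y (Fin.last _) = 0) : fullForm t y (radicalVector t) = 0 := by
  rw [fullForm_skew t hs y _ hy, fullForm_radicalVector_eq_zero t ht y hy hl, star_zero, neg_zero]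

/-- The displacement of `lastVector t` by a braid that acts as a transvection along the radical
vector represents the linear form of the transvection. -/
theorem ActsBy.exists_displacement {t : Fin (n + 2) → Eˣ} {a : PureBraidGroup (n + 1)}
    {φ : (Fin (n + 2) → E) →ₗ[E] E} (ha : ActsBy t a 1 φ) (h1 : ∀ i, IsUnit (1 - (t i : E)))
    (hs : ∀ i, star (t i : E) = ((t i)⁻¹ : Eˣ))
    (ht : character t (strandProd (n + 1) (n + 1)) = 1) :
    ∃ u, boundary t u = 0 ∧ u (Fin.last _) = 0 ∧
      gassner t a (lastVector t) = lastVector t + u ∧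
      ∀ w, boundary t w = 0 → w (Fin.last _) = 0 → fullForm t u w = star (φ w) := by
  have hb : boundary t (gassner t a (lastVector t) - lastVector t) = 0 := by
    rw [map_sub, boundary_gassner, sub_self]
  have hl : (gassner t a (lastVector t) - lastVector t) (Fin.last _) = 0 := by
    rw [Pi.sub_apply, gassner_apply_last t ha.1, sub_self]
  have he : gassner t a (lastVector t) =
      lastVector t + (gassner t a (lastVector t) - lastVector t) := by abel
  generalize gassner t a (lastVector t) - lastVector t = u at hb hl he
  refine ⟨u, hb, hl, he, fun w hw hwl => ?_⟩
  -- Invariance of h on the pair (x₀, w), with h(x₀, v) = -1 and h(u, v) = 0, gives the identity.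
  have e := fullForm_gassner t hs ha.1 (lastVector t) w
  rw [he, ha.2 w hw hwl, one_smul, fullForm_add_left, fullForm_add_right, fullForm_add_right,
    fullForm_smul_right, fullForm_smul_right, fullForm_lastVector_radicalVector t h1 hs ht,
    fullForm_radicalVector_right t hs ht u hb hl] at e
  linear_combination e

/-- On W the two transvections commute. With u' the displacement of x₀ by a, the vectors ab x₀ and
ba x₀ differ by (φ(u) - ψ(u')) v, and skewness of h turns ψ(u') into -star φ(u). -/
theorem ActsBy.commutator_apply {t : Fin (n + 2) → Eˣ} {a b : PureBraidGroup (n + 1)}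
    {φ ψ : (Fin (n + 2) → E) →ₗ[E] E} (ha : ActsBy t a 1 φ) (hb : ActsBy t b 1 ψ)
    (h1 : ∀ i, IsUnit (1 - (t i : E))) (hs : ∀ i, star (t i : E) = ((t i)⁻¹ : Eˣ))
    (ht : character t (strandProd (n + 1) (n + 1)) = 1)
    {u : Fin (n + 2) → E} (hub : boundary t u = 0) (hul : u (Fin.last _) = 0)
    (hu : gassner t b (lastVector t) = lastVector t + u)
    (hψ : ∀ w, boundary t w = 0 → w (Fin.last _) = 0 → fullForm t u w = star (ψ w))
    (w : Fin (n + 2) → E) (hw : boundary t w = 0) (hl : w (Fin.last _) = 0) (c : E) :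
    gassner t (a * b * a⁻¹ * b⁻¹) (w + c • lastVector t) =
      w + c • lastVector t + (c * (φ u + star (φ u))) • radicalVector t := by
  obtain ⟨u', hub', hul', hu', hφ⟩ := ha.exists_displacement h1 hs ht
  have hskew : ψ u' = -star (φ u) := by
    rw [← star_star (ψ u'), ← hψ u' hub' hul', fullForm_skew t hs _ _ hub, hφ u hub hul, star_neg,
      star_star]
  have key : ∀ y (c : E), boundary t y = 0 → y (Fin.last _) = 0 →
      gassner t (a * b) (y + c • lastVector t) = gassner t (b * a) (y + c • lastVector t) +
        (c * (φ u + star (φ u))) • radicalVector t := by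
    intro y c hy hyl
    simp only [map_mul, Module.End.mul_apply, map_add, map_smul, ha.2 y hy hyl, hb.2 y hy hyl,
      hu, hu', ha.2 u hub hul, hb.2 u' hub' hul', gassner_radicalVector t ha.1,
      gassner_radicalVector t hb.1, hskew]
    module
  have hba : b * a ∈ firstStrands n := mul_mem hb.1 ha.1
  have hx : boundary t (w + c • lastVector t) = 0 := by
    rw [map_add, map_smul, hw, boundary_lastVector t h1, smul_zero, add_zero]
  obtain ⟨y, d, hy, hyl, hyd⟩ := eq_add_smul_lastVector t h1
    (gassner t (b * a)⁻¹ (w + c • lastVector t)) (by rw [boundary_gassner, hx])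
  -- Braids on the first strands preserve the last coordinate, hence the coefficient of x₀.
  have hcd : d = c := by
    have e := congrFun hyd (Fin.last _)
    rw [gassner_apply_last t (inv_mem hba)] at e
    simp only [Pi.add_apply, Pi.smul_apply, hl, hyl, zero_add, smul_eq_mul] at e
    linear_combination (1 - (t (Fin.last _) : E)) * e - (c - d) * mul_lastVector_last t h1
  have e : a * b * a⁻¹ * b⁻¹ = a * b * (b * a)⁻¹ := by group
  rw [e, map_mul, Module.End.mul_apply, hyd, key y d hy hyl, ← hyd, gassner_apply_inv, hcd]

end Commutators

/-! ### Invertibility of 2 in the scalar ring. -/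

theorem isUnit_two_of_odd_card {E : Type*} [CommRing E] (h : Odd (Nat.card E)) :
    IsUnit (2 : E) := by
  obtain ⟨k, hk⟩ := h
  -- The order 2k + 1 of the additive group kills 1, so -k is the inverse of 2.
  have e : Nat.card E • (1 : E) = 0 := card_nsmul_eq_zero'
  rw [hk, nsmul_one] at e
  push_cast at e
  exact IsUnit.of_mul_eq_one (-(k : E)) (by linear_combination -e)

theorem IsScalarRing.odd_card {E : Type*} [CommRing E] [StarRing E] {q : ℕ}
    (hE : IsScalarRing q E) (hq : Odd q) : Odd (Nat.card E) := by
  rcases hE with ⟨_, h, _⟩ | ⟨F, _, e, h, _⟩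
  · rw [h]; exact hq.pow
  · rw [Nat.card_congr e.toEquiv, Nat.card_prod, h]; exact hq.mul hq

end Gassner

end

/-! ### The proposition: unitary transvections as commutators. -/

theorem mainTheorem5 {E : Type*} [CommRing E] [StarRing E] (q : ℕ)
    (hE : Gassner.IsScalarRing q E) (hq : Odd q) (n : ℕ) (hn : 2 < n)
    (t : Fin (n + 2) → Eˣ)
    (ht_unitary : ∀ i, star (t i : E) = ((t i)⁻¹ : Eˣ))
    (ht_one : ∀ i, IsUnit ((t i : E) - 1))
    (ht_gen : Subring.closure (Set.range fun i : Fin (n + 1) => (t i.castSucc : E)) = ⊤)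
    (ht_prod : ∏ i : Fin (n + 1), t i.castSucc = 1) :
    ∃ v : Gassner.ReducedSpace t, Gassner.IsIsotropic t v ∧
      (∀ T, Gassner.IsUnitaryTransvection t v T → T ∈ (Gassner.reducedGassner t).range) ∧
      (∀ w : Gassner.ReducedSpace t, w ∈ Submodule.span E {v} ↔
        w ∈ Gassner.coordHyperplane t ∧
          ∀ u ∈ Gassner.coordHyperplane t, Gassner.gassnerForm t w u = 0) ∧
      (∀ T, Gassner.IsUnitaryTransvection t v T →
        ∃ a ∈ Gassner.firstStrands n, ∃ b ∈ Gassner.firstStrands n,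
          Gassner.IsTransvectionOn (Gassner.coordHyperplane t) v (Gassner.reducedGassner t a) ∧
          Gassner.IsTransvectionOn (Gassner.coordHyperplane t) v (Gassner.reducedGassner t b) ∧
          T = Gassner.reducedGassner t (a * b * a⁻¹ * b⁻¹)) := by
  open Gassner in
  have h1 : ∀ i, IsUnit (1 - (t i : E)) := fun i => by simpa using (ht_one i).neg
  have ht : character t (strandProd (n + 1) (n + 1)) = 1 := by
    rw [character_strandProd, ht_prod]
  have hvb := boundary_radicalVector t ht
  have hvl := radicalVector_last t
  have hvv := fullForm_radicalVector_eq_zero t ht _ hvb hvl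
  set v : ReducedSpace t := ⟨radicalVector t, hvb⟩ with hv
  have hmem : ∀ w : ReducedSpace t, w ∈ coordHyperplane t ↔
      (w : Fin (n + 2) → E) (Fin.last _) = 0 := fun w => Iff.rfl
  have hvmem : v ∈ coordHyperplane t := (hmem v).2 hvl
  have htrans : ∀ (a : PureBraidGroup (n + 1)) (φ : (Fin (n + 2) → E) →ₗ[E] E), ActsBy t a 1 φ →
      φ (radicalVector t) = 0 →
        IsTransvectionOn (coordHyperplane t) v (reducedGassner t a) := by
    intro a φ ha hφ
    refine ⟨hvmem, φ.comp ((ReducedSpace t).subtype.comp (coordHyperplane t).subtype), hφ,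
      fun w => Subtype.ext ?_⟩
    have e := ha.2 _ w.1.2 w.2
    rw [one_smul] at e
    exact e
  have main : ∀ T, IsUnitaryTransvection t v T →
        ∃ a ∈ firstStrands n, ∃ b ∈ firstStrands n,
          IsTransvectionOn (coordHyperplane t) v (reducedGassner t a) ∧
          IsTransvectionOn (coordHyperplane t) v (reducedGassner t b) ∧
          T = reducedGassner t (a * b * a⁻¹ * b⁻¹) := by
    rintro T ⟨hT, _, φ, hφv, hφ⟩
    have hx0 := boundary_lastVector t h1
    set ψ : ReducedSpace t → E := fun x => φ ⟨x, trivial⟩ with hψ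
    set x0 : ReducedSpace t := ⟨lastVector t, hx0⟩ with hx0def
    have hT' : ∀ x : ReducedSpace t, ((T.1 x : ReducedSpace t) : Fin (n + 2) → E) =
        x + ψ x • radicalVector t := fun x => congrArg Subtype.val (hφ ⟨x, trivial⟩)
    -- Unitarity of T, expanded with h(v, v) = 0. Testing it on (x₀, w) and (x₀, x₀) shows that ψ
    -- vanishes on W and that ψ(x₀) is self-adjoint, so T is determined by ψ(x₀).
    have hform : ∀ x y : ReducedSpace t,
        ψ x * fullForm t (radicalVector t) y + star (ψ y) * fullForm t x (radicalVector t) = 0 := by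
      intro x y
      have e := hT x y
      rw [gassnerForm_eq, gassnerForm_eq, hT', hT', fullForm_add_left, fullForm_add_right,
        fullForm_add_right, fullForm_smul_left, fullForm_smul_left, fullForm_smul_right,
        fullForm_smul_right, hvv] at e
      linear_combination e
    have hψW : ∀ w : ReducedSpace t, (w : Fin (n + 2) → E) (Fin.last _) = 0 → ψ w = 0 := by
      intro w hw
      have e := hform x0 w
      rw [fullForm_radicalVector_eq_zero t ht w w.2 hw,
        fullForm_lastVector_radicalVector t h1 ht_unitary ht] at e
      rw [← star_star (ψ w), show star (ψ w) = 0 by linear_combination -e, star_zero]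
    have hr : star (ψ x0) = ψ x0 := by
      have e := hform x0 x0
      rw [fullForm_radicalVector_lastVector t h1 ht,
        fullForm_lastVector_radicalVector t h1 ht_unitary ht] at e
      linear_combination -e
    obtain ⟨b, hb⟩ := exists_actsBy_smul_rootForm t h1 ht ht_gen ⟨1, by omega⟩ 1
    obtain ⟨u, hub, hul, hu, huψ⟩ := hb.exists_displacement h1 ht_unitary ht
    set i0 : Fin n := ⟨0, by omega⟩ with hi0
    -- This value is h(u, ε_0), which by the choice of b is the conjugate of h(ε_0, ε_1), a unit.
    have hunit : IsUnit (rootForm t i0.castSucc u) := by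
      rw [rootForm_apply, ← fullForm_simpleVector t h1, huψ _ (boundary_simpleVector t h1 _)
        (simpleVector_castSucc_last t i0), one_smul]
      exact (isUnit_rootForm_simpleVector t h1 rfl).star
    obtain ⟨k, hk⟩ := hunit
    obtain ⟨two, htwo⟩ := isUnit_two_of_odd_card (hE.odd_card hq)
    obtain ⟨r, h2r⟩ : ∃ r : E, 2 * r = ψ x0 :=
      ⟨(two⁻¹ : Eˣ) * ψ x0, by rw [← htwo, Units.mul_inv_cancel_left]⟩
    have hrstar : star r = r := by
      have e : (2 : E) * star r = 2 * r := by
        rw [h2r, ← hr, ← h2r, star_mul', star_ofNat]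
      rw [← htwo] at e
      exact two.isUnit.mul_left_cancel e
    -- The coefficient makes φ(u) = r, so the commutator moves x₀ by (r + star r) v = 2r v = ψ(x₀)
    -- v, exactly as T does.
    obtain ⟨a, ha⟩ := exists_actsBy_smul_rootForm t h1 ht ht_gen i0 (r * (k⁻¹ : Eˣ))
    have hφu : ((r * (k⁻¹ : Eˣ)) • rootForm t i0.castSucc) u = r := by
      rw [LinearMap.smul_apply, ← hk, smul_eq_mul, mul_assoc, Units.inv_mul, mul_one]
    refine ⟨a, ha.1, b, hb.1, htrans a _ ha ?_, htrans b _ hb ?_, Units.ext ?_⟩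
    · rw [LinearMap.smul_apply, rootForm_radicalVector, smul_zero]
    · rw [LinearMap.smul_apply, rootForm_radicalVector, smul_zero]
    · refine LinearMap.ext fun x => Subtype.ext ?_
      obtain ⟨w, c, hw, hwl, hx⟩ := eq_add_smul_lastVector t h1 x x.2
      have hψx : ψ x = c * ψ x0 := by
        have : x = (⟨w, hw⟩ : ReducedSpace t) + c • x0 := Subtype.ext hx
        have e : ψ x = ψ ⟨w, hw⟩ + c * ψ x0 := by
          rw [this]
          exact (map_add φ ⟨_, trivial⟩ (c • ⟨_, trivial⟩)).trans
            (congrArg _ (map_smul φ c _))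
        rw [e, hψW _ hwl, zero_add]
      rw [hT', coe_reducedGassner, hψx, hx,
        ha.commutator_apply hb h1 ht_unitary ht hub hul hu huψ w hw hwl c, hφu, hrstar, ← h2r]
      module
  refine ⟨v, ⟨?_, fun a ha => ?_⟩, fun T hT => ?_, fun w => ⟨fun hw => ?_, fun hw => ?_⟩, main⟩
  · rw [gassnerForm_eq]; exact hvv
  -- The coordinate of v at strand 0 is 1, so only the zero scalar kills v.
  · have e := congrFun (congrArg Subtype.val ha) 0
    simpa [hv, radicalVector_zero] using e
  · obtain ⟨a, _, b, _, _, _, rfl⟩ := main T hT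
    exact ⟨_, rfl⟩
  · obtain ⟨c, rfl⟩ := Submodule.mem_span_singleton.1 hw
    refine ⟨Submodule.smul_mem _ c hvmem, fun u hu => ?_⟩
    rw [gassnerForm_eq, Submodule.coe_smul, fullForm_smul_left,
      fullForm_radicalVector_eq_zero t ht u u.2 hu, mul_zero]
  · refine Submodule.mem_span_singleton.2 ⟨(w : Fin (n + 2) → E) 0, Subtype.ext ?_⟩
    refine (eq_smul_radicalVector t h1 w hw.1 fun i => ?_).symm
    rw [← hw.2 ⟨simpleVector t i.castSucc, boundary_simpleVector t h1 _⟩ ?_, gassnerForm_eq]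
    exact (hmem _).2 (simpleVector_castSucc_last t i)
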